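/- **Setting.** Let $m\in\mathbb N$, write $\|\cdot\|$ for the operator norm on $\mathbb C^{m\times m}$ induced by the Euclidean norm of $\mathbb C^m$, and let $\alpha=(\alpha_k)_{k\in\mathbb Z}\subset\mathbb C^{m\times m}$ satisfy $\|\alpha_k\|<1$ for all $k$. Put $\rho_k=(I_m-\alpha_k^*\alpha_k)^{1/2}$, $\widetilde\rho_k=(I_m-\alpha_k\alpha_k^*)^{1/2}$ and $$\Theta_k=\begin{pmatrix}-\alpha_k&\widetilde\rho_k\\ \rho_k&\alpha_k^*\end{pmatrix}.$$ On $\ell^2(\mathbb Z)^m$ let $\mathbb V$ (resp. $\mathbb W$) be the direct sum of the blocks $\Theta_k$ with $k$ even (resp. odd), where $\Theta_k$ acts on the coordinates $(k-1,k)$, and let $\mathbb U=\mathbb V\mathbb W$ be the (unitary) CMV operator. For $z\ne0$ put $$\mathbb T(z,k)=\begin{pmatrix}\widetilde\rho_k^{-1}\alpha_k&z\widetilde\rho_k^{-1}\\ z^{-1}\rho_k^{-1}&\rho_k^{-1}\alpha_k^*\end{pmatrix}\ (k\text{ odd}),\qquad \mathbb T(z,k)=\begin{pmatrix}\rho_k^{-1}\alpha_k^*&\rho_k^{-1}\\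 \widetilde\rho_k^{-1}&\widetilde\rho_k^{-1}\alpha_k\end{pmatrix}\ (k\text{ even}).$$ Fix $k_0\in\mathbb Z$, a unitary $\gamma\in\mathbb C^{m\times m}$ and a unitary square root $\gamma^{1/2}$ of $\gamma$, with inverse $\gamma^{-1/2}$. Let $\binom{P_+^{(\gamma)}(z,k,k_0)}{R_+^{(\gamma)}(z,k,k_0)}$ and $\binom{Q_+^{(\gamma)}(z,k,k_0)}{S_+^{(\gamma)}(z,k,k_0)}$, $k\in\mathbb Z$, be the $\mathbb C^{2m\times m}$-valued solutions of $Y(k)=\mathbb T(z,k)Y(k-1)$, $k\in\mathbb Z$, whose values at $k=k_0$ are $\binom{z\gamma^{1/2}}{\gamma^{-1/2}}$ and $\binom{z\gamma^{1/2}}{-\gamma^{-1/2}}$ if $k_0$ is odd, and $\binom{\gamma^{-1/2}}{\gamma^{1/2}}$ and $\binom{-\gamma^{-1/2}}{\gamma^{1/2}}$ if $k_0$ is even. **Lemma 3.14.** (a) Let $z\in\mathbb C\setminus(\partial\mathbb D\cup\{0\})$. There are unique matrices $M_\pm^{(\gamma)}(z,k_0)\in\mathbb C^{m\times m}$ such that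 $$U^{(\gamma)}_\pm(z,\cdot,k_0)=Q_+^{(\gamma)}(z,\cdot,k_0)+P_+^{(\gamma)}(z,\cdot,k_0)M_\pm^{(\gamma)}(z,k_0),\qquad V^{(\gamma)}_\pm(z,\cdot,k_0)=S_+^{(\gamma)}(z,\cdot,k_0)+R_+^{(\gamma)}(z,\cdot,k_0)M_\pm^{(\gamma)}(z,k_0)$$ are square summable on $[k_0,\infty)\cap\mathbb Z$ for the sign $+$ and on $(-\infty,k_0]\cap\mathbb Z$ for the sign $-$. The matrix $W^{(\gamma)}(z,k_0)=M_+^{(\gamma)}(z,k_0)-M_-^{(\gamma)}(z,k_0)$ is invertible, and for every $k\in\mathbb Z$ it is minus the Wronskian of $U_+^{(\gamma)}(1/\bar z,\cdot,k_0)$ and $U_-^{(\gamma)}(z,\cdot,k_0)$ at $k$, where the Wronskian of two $\mathbb C^{m\times m}$-valued sequences $\Phi_1,\Phi_2$ at $k$ is $$\tfrac{(-1)^{k+1}}2\big[\Phi_1(k)^*\Phi_2(k)-(\mathbb V^*\Phi_1)(k)^*(\mathbb V^*\Phi_2)(k)\big],$$ with $\mathbb V^*$ understood as a difference expression. The operator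 $\mathbb U-z$ is boundedly invertible, and in the standard basis of $\ell^2(\mathbb Z)^m$ its inverse has the $m\times m$ matrix entries $$(\mathbb U-z)^{-1}(k,k')=\frac1{2z}\begin{cases}U^{(\gamma)}_-(z,k,k_0)\,W^{(\gamma)}(z,k_0)^{-1}\,U^{(\gamma)}_+(1/\bar z,k',k_0)^*,& k<k'\text{ or }k=k'\text{ odd},\\ U^{(\gamma)}_+(z,k,k_0)\,W^{(\gamma)}(z,k_0)^{-1}\,U^{(\gamma)}_-(1/\bar z,k',k_0)^*,& k>k'\text{ or }k=k'\text{ even},\end{cases}\qquad k,k'\in\mathbb Z.$$ (b) The operator $\mathbb U$ is boundedly invertible, and the formula extends analytically to $z=0$: for all $k,k'\in\mathbb Z$ the right-hand side, extended to $z=0$ by the value $\mathbb U^{-1}(k,k')$, is an analytic function of $z\in\mathbb C\setminus\partial\mathbb D$. -/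

import Mathlib

open scoped Matrix MatrixOrder Matrix.Norms.L2Operator ComplexConjugate

namespace CMV

/-- Complex `m × m` matrices. The norm on them is the operator norm induced by the Euclidean
norm on `ℂᵐ`. -/
abbrev Mat (m : ℕ) : Type := Matrix (Fin m) (Fin m) ℂ

/-- `ℂᵐ` with its Euclidean norm. -/
abbrev Vec (m : ℕ) : Type := EuclideanSpace ℂ (Fin m)

/-- The Hilbert space `ℓ²(ℤ)ᵐ` of square summable `ℂᵐ`-valued sequences. -/
abbrev L2 (m : ℕ) : Type := lp (fun _ : ℤ => Vec m) 2

variable {m : ℕ}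

/-- The matrix `A` acting on the vector `x`. -/
noncomputable def act (A : Mat m) (x : Vec m) : Vec m := Matrix.toEuclideanCLM (𝕜 := ℂ) A x

/-- `ρ_k = (I - α_k* α_k)^{1/2}`, the nonnegative square root. -/
noncomputable def rho (α : ℤ → Mat m) (k : ℤ) : Mat m := CFC.sqrt (1 - (α k)ᴴ * α k)

/-- `ρ̃_k = (I - α_k α_k*)^{1/2}`, the nonnegative square root. -/
noncomputable def rhoT (α : ℤ → Mat m) (k : ℤ) : Mat m := CFC.sqrt (1 - α k * (α k)ᴴ)

/-- The block diagonal difference expression built from the blocks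
`Θ_n = [[-α_n, ρ̃_n], [ρ_n, α_n*]]`, where `Θ_n` acts on the coordinates `(n - 1, n)` and `n`
runs through the integers satisfying `p`. It is used for `p = Even` and `p = Odd`, where each
integer `k` lies in exactly one of the pairs: the second of `(k - 1, k)` if `p k`, and the first
of `(k, k + 1)` otherwise. -/
noncomputable def blockExpr (p : ℤ → Prop) [DecidablePred p] (α : ℤ → Mat m) (φ : ℤ → Vec m)
    (k : ℤ) : Vec m :=
  if p k then act (rho α k) (φ (k - 1)) + act (α k)ᴴ (φ k)
  else act (-α (k + 1)) (φ k) + act (rhoT α (k + 1)) (φ (k + 1))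

lemma norm_act_le (A : Mat m) (x : Vec m) : ‖act A x‖ ≤ ‖A‖ * ‖x‖ :=
  (Matrix.toEuclideanCLM (𝕜 := ℂ) A).le_opNorm x

lemma norm_sqrt_le (B : Mat m) (hB : ‖B‖ < 1) : ‖CFC.sqrt (1 - Bᴴ * B)‖ ≤ 2 := by
  have h1 : ‖Bᴴ * B‖ ≤ 1 := by
    rw [Matrix.l2_opNorm_conjTranspose_mul_self]; nlinarith [norm_nonneg B]
  have h0 : (0 : Mat m) ≤ 1 - Bᴴ * B := by
    rw [sub_nonneg]
    exact (CStarAlgebra.norm_le_one_iff_of_nonneg _ (star_mul_self_nonneg B)).1 h1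
  have hone : ‖(1 : Mat m)‖ ≤ 1 := by
    rw [Matrix.cstar_norm_def, map_one]; exact ContinuousLinearMap.norm_id_le
  have hs : IsSelfAdjoint (CFC.sqrt (1 - Bᴴ * B)) := (CFC.sqrt_nonneg _).isSelfAdjoint
  have h2 : ‖CFC.sqrt (1 - Bᴴ * B)‖ * ‖CFC.sqrt (1 - Bᴴ * B)‖ ≤ 2 := by
    rw [← CStarRing.norm_star_mul_self, hs.star_eq, CFC.sqrt_mul_sqrt_self _ h0]
    linarith [norm_sub_le (1 : Mat m) (Bᴴ * B)]
  nlinarith [norm_nonneg (CFC.sqrt (1 - Bᴴ * B))]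

lemma norm_rho_le {α : ℤ → Mat m} (hα : ∀ k, ‖α k‖ < 1) (k : ℤ) : ‖rho α k‖ ≤ 2 :=
  norm_sqrt_le _ (hα k)

lemma norm_rhoT_le {α : ℤ → Mat m} (hα : ∀ k, ‖α k‖ < 1) (k : ℤ) : ‖rhoT α k‖ ≤ 2 := by
  have := norm_sqrt_le (α k)ᴴ (by rw [Matrix.l2_opNorm_conjTranspose]; exact hα k)
  rwa [Matrix.conjTranspose_conjTranspose] at this

lemma norm_blockExpr_le (p : ℤ → Prop) [DecidablePred p] {α : ℤ → Mat m}
    (hα : ∀ k, ‖α k‖ < 1) (φ : ℤ → Vec m) (k : ℤ) :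
    ‖blockExpr p α φ k‖ ≤ 2 * ‖φ (k - 1)‖ + 2 * ‖φ k‖ + 2 * ‖φ (k + 1)‖ := by
  have key : ∀ (A : Mat m) (x : Vec m), ‖A‖ ≤ 2 → ‖act A x‖ ≤ 2 * ‖x‖ := fun A x hA =>
    (norm_act_le A x).trans (mul_le_mul_of_nonneg_right hA (norm_nonneg x))
  unfold blockExpr
  split_ifs
  · have h1 := key _ (φ (k - 1)) (norm_rho_le hα k)
    have h2 := key (α k)ᴴ (φ k) (by rw [Matrix.l2_opNorm_conjTranspose]; linarith [hα k])
    linarith [norm_add_le (act (rho α k) (φ (k - 1))) (act (α k)ᴴ (φ k)),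
      norm_nonneg (φ (k + 1))]
  · have h1 := key (-α (k + 1)) (φ k) (by rw [norm_neg]; linarith [hα (k + 1)])
    have h2 := key _ (φ (k + 1)) (norm_rhoT_le hα (k + 1))
    linarith [norm_add_le (act (-α (k + 1)) (φ k)) (act (rhoT α (k + 1)) (φ (k + 1))),
      norm_nonneg (φ (k - 1))]

/-- The sequence of norms of `φ`, shifted by `c`, as an element of the real `ℓ²(ℤ)`. -/
noncomputable def normShift (c : ℤ) (φ : L2 m) : lp (fun _ : ℤ => ℝ) 2 :=
  ⟨fun k => ‖φ (k + c)‖, by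
    refine (memℓp_gen_iff (by norm_num)).2 ?_
    have h := (memℓp_gen_iff (by norm_num)).1 (lp.memℓp φ)
    simp only [norm_norm]
    exact (Equiv.addRight c).summable_iff.2 h⟩

lemma norm_normShift (c : ℤ) (φ : L2 m) : ‖normShift c φ‖ = ‖φ‖ := by
  rw [lp.norm_eq_tsum_rpow (by norm_num), lp.norm_eq_tsum_rpow (by norm_num)]
  congr 1
  have := (Equiv.addRight c).tsum_eq (fun k => ‖φ k‖ ^ (2 : ENNReal).toReal)
  rw [← this]
  simp [normShift]

/-- A square summable majorant of `blockExpr p α φ`. -/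
noncomputable def majorant (φ : L2 m) : lp (fun _ : ℤ => ℝ) 2 :=
  (2 : ℝ) • normShift (-1) φ + (2 : ℝ) • normShift 0 φ + (2 : ℝ) • normShift 1 φ

lemma norm_blockExpr_le_majorant (p : ℤ → Prop) [DecidablePred p] {α : ℤ → Mat m}
    (hα : ∀ k, ‖α k‖ < 1) (φ : L2 m) (k : ℤ) : ‖blockExpr p α φ k‖ ≤ majorant φ k := by
  have h : majorant φ k = 2 * ‖φ (k + -1)‖ + 2 * ‖φ (k + 0)‖ + 2 * ‖φ (k + 1)‖ := rfl
  rw [h, add_zero, ← sub_eq_add_neg]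
  exact norm_blockExpr_le p hα φ k

lemma norm_majorant_le (φ : L2 m) : ‖majorant φ‖ ≤ 6 * ‖φ‖ := by
  have h : ∀ c : ℤ, ‖(2 : ℝ) • normShift c φ‖ = 2 * ‖φ‖ := fun c => by
    rw [norm_smul, norm_normShift]; norm_num
  refine (norm_add_le _ _).trans ?_
  refine (add_le_add (norm_add_le _ _) le_rfl).trans ?_
  rw [h, h, h]; linarith

/-- The bounded operator on `ℓ²(ℤ)ᵐ` given by the block diagonal expression `blockExpr`. -/
noncomputable def blockOp (p : ℤ → Prop) [DecidablePred p] (α : ℤ → Mat m)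
    (hα : ∀ k, ‖α k‖ < 1) : L2 m →L[ℂ] L2 m :=
  LinearMap.mkContinuous
    { toFun := fun φ => ⟨blockExpr p α φ,
        (lp.memℓp (majorant φ)).mono fun k => norm_blockExpr_le_majorant p hα φ k⟩
      map_add' := fun φ ψ => by
        ext1; funext k
        simp only [blockExpr, act, lp.coeFn_add, Pi.add_apply, map_add]
        split_ifs <;> abel
      map_smul' := fun c φ => by
        ext1; funext k
        simp only [blockExpr, act, lp.coeFn_smul, Pi.smul_apply, map_smul, RingHom.id_apply]
        split_ifs <;> rw [smul_add] }
    6 (fun φ => by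
      refine le_trans ?_ (norm_majorant_le φ)
      exact lp.norm_mono (by norm_num) fun k =>
        (norm_blockExpr_le_majorant p hα φ k).trans (Real.le_norm_self _))

/-- The operator `𝕍` on `ℓ²(ℤ)ᵐ`, the direct sum of the blocks `Θ_n` with `n` even. -/
noncomputable def opV (α : ℤ → Mat m) (hα : ∀ k, ‖α k‖ < 1) : L2 m →L[ℂ] L2 m :=
  blockOp Even α hα

/-- The operator `𝕎` on `ℓ²(ℤ)ᵐ`, the direct sum of the blocks `Θ_n` with `n` odd. -/
noncomputable def opW (α : ℤ → Mat m) (hα : ∀ k, ‖α k‖ < 1) : L2 m →L[ℂ] L2 m :=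
  blockOp Odd α hα

/-- The full-lattice CMV operator `𝕌 = 𝕍𝕎`. -/
noncomputable def opU (α : ℤ → Mat m) (hα : ∀ k, ‖α k‖ < 1) : L2 m →L[ℂ] L2 m :=
  opV α hα * opW α hα

/-- The resolvent `(𝕌 - z)⁻¹` (meaningful when `𝕌 - z` is invertible). -/
noncomputable def resolventU (α : ℤ → Mat m) (hα : ∀ k, ‖α k‖ < 1) (z : ℂ) :
    L2 m →L[ℂ] L2 m :=
  Ring.inverse (opU α hα - z • (1 : L2 m →L[ℂ] L2 m))

/-- The `m × m` block `A(k, k')` of a bounded operator `A` on `ℓ²(ℤ)ᵐ` in the standard basis. -/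
noncomputable def kernel (A : L2 m →L[ℂ] L2 m) (k k' : ℤ) : Mat m :=
  Matrix.of fun i j => (A (lp.single 2 k' (EuclideanSpace.single j (1 : ℂ))) : ℤ → Vec m) k i

/-- The transfer matrix `𝕋(z, k)`. -/
noncomputable def transfer (α : ℤ → Mat m) (z : ℂ) (k : ℤ) :
    Matrix (Fin m ⊕ Fin m) (Fin m ⊕ Fin m) ℂ :=
  if Odd k then
    Matrix.fromBlocks ((rhoT α k)⁻¹ * α k) (z • (rhoT α k)⁻¹)
      (z⁻¹ • (rho α k)⁻¹) ((rho α k)⁻¹ * (α k)ᴴ)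
  else
    Matrix.fromBlocks ((rho α k)⁻¹ * (α k)ᴴ) (rho α k)⁻¹
      (rhoT α k)⁻¹ ((rhoT α k)⁻¹ * α k)

/-- `𝕋(z, k₀ + n) ⋯ 𝕋(z, k₀ + 1) X`. -/
noncomputable def forward (α : ℤ → Mat m) (z : ℂ) (k₀ : ℤ)
    (X : Matrix (Fin m ⊕ Fin m) (Fin m) ℂ) : ℕ → Matrix (Fin m ⊕ Fin m) (Fin m) ℂ
  | 0 => X
  | n + 1 => transfer α z (k₀ + n + 1) * forward α z k₀ X n

/-- `𝕋(z, k₀ - n + 1)⁻¹ ⋯ 𝕋(z, k₀)⁻¹ X`. -/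
noncomputable def backward (α : ℤ → Mat m) (z : ℂ) (k₀ : ℤ)
    (X : Matrix (Fin m ⊕ Fin m) (Fin m) ℂ) : ℕ → Matrix (Fin m ⊕ Fin m) (Fin m) ℂ
  | 0 => X
  | n + 1 => (transfer α z (k₀ - n))⁻¹ * backward α z k₀ X n

/-- The solution `Y` of `Y(k) = 𝕋(z, k) Y(k - 1)`, `k ∈ ℤ`, with `Y(k₀) = X`. -/
noncomputable def solution (α : ℤ → Mat m) (z : ℂ) (k₀ : ℤ)
    (X : Matrix (Fin m ⊕ Fin m) (Fin m) ℂ) (k : ℤ) : Matrix (Fin m ⊕ Fin m) (Fin m) ℂ :=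
  if k₀ ≤ k then forward α z k₀ X (k - k₀).toNat else backward α z k₀ X (k₀ - k).toNat

/-- The solution `(P₊, R₊)`, stacked in a column; here `g = γ^{1/2}`. -/
noncomputable def solPR (α : ℤ → Mat m) (g : Mat m) (z : ℂ) (k₀ k : ℤ) :
    Matrix (Fin m ⊕ Fin m) (Fin m) ℂ :=
  solution α z k₀ (if Odd k₀ then Matrix.fromRows (z • g) g⁻¹ else Matrix.fromRows g⁻¹ g) k

/-- The solution `(Q₊, S₊)`, stacked in a column; here `g = γ^{1/2}`. -/
noncomputable def solQS (α : ℤ → Mat m) (g : Mat m) (z : ℂ) (k₀ k : ℤ) :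
    Matrix (Fin m ⊕ Fin m) (Fin m) ℂ :=
  solution α z k₀ (if Odd k₀ then Matrix.fromRows (z • g) (-g⁻¹) else Matrix.fromRows (-g⁻¹) g) k

/-- The sequence `Q₊(z, ·, k₀) + P₊(z, ·, k₀) M`. -/
noncomputable def combU (α : ℤ → Mat m) (g : Mat m) (z : ℂ) (k₀ : ℤ) (M : Mat m) (k : ℤ) :
    Mat m :=
  (solQS α g z k₀ k).toRows₁ + (solPR α g z k₀ k).toRows₁ * M

/-- The sequence `S₊(z, ·, k₀) + R₊(z, ·, k₀) M`. -/
noncomputable def combV (α : ℤ → Mat m) (g : Mat m) (z : ℂ) (k₀ : ℤ) (M : Mat m) (k : ℤ) :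
    Mat m :=
  (solQS α g z k₀ k).toRows₂ + (solPR α g z k₀ k).toRows₂ * M

/-- `Q₊ + P₊ M` and `S₊ + R₊ M` are square summable on `J ⊆ ℤ`. -/
def IsWeyl (J : Set ℤ) (α : ℤ → Mat m) (g : Mat m) (z : ℂ) (k₀ : ℤ) (M : Mat m) : Prop :=
  Memℓp (fun k : J => combU α g z k₀ M k) 2 ∧ Memℓp (fun k : J => combV α g z k₀ M k) 2

/-- The half-lattice Weyl--Titchmarsh function `M₊(z, k₀)`: the matrix `M` for which
`Q₊ + P₊ M` and `S₊ + R₊ M` are square summable on `[k₀, ∞)`. -/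
noncomputable def Mplus (α : ℤ → Mat m) (g : Mat m) (z : ℂ) (k₀ : ℤ) : Mat m :=
  Classical.epsilon fun M => IsWeyl (Set.Ici k₀) α g z k₀ M

/-- The half-lattice Weyl--Titchmarsh function `M₋(z, k₀)`: the matrix `M` for which
`Q₊ + P₊ M` and `S₊ + R₊ M` are square summable on `(-∞, k₀]`. -/
noncomputable def Mminus (α : ℤ → Mat m) (g : Mat m) (z : ℂ) (k₀ : ℤ) : Mat m :=
  Classical.epsilon fun M => IsWeyl (Set.Iic k₀) α g z k₀ M

/-- The Weyl--Titchmarsh solution `U₊(z, k, k₀)`. -/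
noncomputable def Uplus (α : ℤ → Mat m) (g : Mat m) (z : ℂ) (k k₀ : ℤ) : Mat m :=
  combU α g z k₀ (Mplus α g z k₀) k

/-- The Weyl--Titchmarsh solution `U₋(z, k, k₀)`. -/
noncomputable def Uminus (α : ℤ → Mat m) (g : Mat m) (z : ℂ) (k k₀ : ℤ) : Mat m :=
  combU α g z k₀ (Mminus α g z k₀) k

/-- The difference expression `𝕍*` on `m × m` matrix-valued sequences: the direct sum of the
blocks `Θ_n* = [[-α_n*, ρ_n], [ρ̃_n, α_n]]`, `n` even, acting on the coordinates `(n - 1, n)`. -/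
noncomputable def exprVadj (α : ℤ → Mat m) (Φ : ℤ → Mat m) (k : ℤ) : Mat m :=
  if Even k then rhoT α k * Φ (k - 1) + α k * Φ k
  else -(α (k + 1))ᴴ * Φ k + rho α (k + 1) * Φ (k + 1)

/-- The Wronskian `(-1)^{k+1}/2 [Φ₁(k)* Φ₂(k) - (𝕍* Φ₁)(k)* (𝕍* Φ₂)(k)]`. -/
noncomputable def wronskian (α : ℤ → Mat m) (Φ₁ Φ₂ : ℤ → Mat m) (k : ℤ) : Mat m :=
  ((-1 : ℂ) ^ (k + 1) / 2) •
    ((Φ₁ k)ᴴ * Φ₂ k - (exprVadj α Φ₁ k)ᴴ * exprVadj α Φ₂ k)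

/-- `W(z, k₀) = M₊(z, k₀) - M₋(z, k₀)`. -/
noncomputable def weylW (α : ℤ → Mat m) (g : Mat m) (z : ℂ) (k₀ : ℤ) : Mat m :=
  Mplus α g z k₀ - Mminus α g z k₀

/-- The explicit kernel
`(1/2z) U₋(z, k, k₀) W(z, k₀)⁻¹ U₊(1/z̄, k', k₀)*` if `k < k'` or `k = k'` is odd, and
`(1/2z) U₊(z, k, k₀) W(z, k₀)⁻¹ U₋(1/z̄, k', k₀)*` if `k > k'` or `k = k'` is even. -/
noncomputable def greenKernel (α : ℤ → Mat m) (g : Mat m) (k₀ : ℤ) (z : ℂ) (k k' : ℤ) : Mat m :=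
  (1 / (2 * z)) •
    if k < k' ∨ (k = k' ∧ Odd k) then
      Uminus α g z k k₀ * (weylW α g z k₀)⁻¹ * (Uplus α g (1 / conj z) k' k₀)ᴴ
    else
      Uplus α g z k k₀ * (weylW α g z k₀)⁻¹ * (Uminus α g (1 / conj z) k' k₀)ᴴ

end CMV

/-!
The eigenvalue equation `𝕌 u = z u` is treated as the first order system `𝕎 u = z v`, `𝕍 v = u`
(`IsSol`, and `IsMatSol` for matrices), which on the blocks `Θ_k` is the transfer recursion
(`isMatSol_solution`). Three consequences of the unitarity of the blocks carry the proof.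

* `𝕍`, `𝕎` and hence `𝕌` are unitary, so the spectrum of `𝕌` lies on the unit circle and `𝕌 - z` is
  invertible for `|z| ≠ 1` (`isUnit_opU_sub`).

* For a solution, `(‖u‖² - ‖v‖²) / (|z|² - 1)`, with alternating sign, is nondecreasing along `ℤ`
  (`IsSol.energy_mono`). It tends to zero at an end where the solution is square summable. So no
  nonzero solution is square summable at both ends, and no nonzero `(P₊ x, R₊ x)` is square summable
  at either end. On the other hand, cutting a solution off and correcting it by the resolvent
  writes it as a sum of two solutions, each square summable at one end
  (`IsSol.exists_decomposition`). In the coordinates `(y, x)` of the solution `Q₊ y + P₊ x`, a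
  dimension count then shows that the solutions that are square summable at an end are those on the
  graph of a matrix, `x = M y` (`existsUnique_isWeylAt`), and `M₊ - M₋` is injective
  (`isUnit_weylW`).

* The Wronskian of a solution at `1 / z̄` and a solution at `z` is constant
  (`IsMatSol.wronskian_const`), equal to `M'* + M` for the solutions with the matrices `M'` and `M`.
  For two Weyl solutions at the same end it vanishes, so `M±(1 / z̄)* = -M±(z)`, and the mixed
  Wronskians are `∓W`. Inverting the `2 × 2` block matrix of Weyl solutions by means of these
  Wronskians gives the jump on the diagonal of the two branches of the kernel (`weyl_jump`). Hence
  its columns solve `(𝕌 - z) φ = δ` (`exists_green_column`).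

The blocks of the resolvent are holomorphic off the circle, also at `z = 0`, which gives the
analytic extension of the kernel.
-/

namespace CMV

variable {m : ℕ}

/-! ### The defect matrices -/

lemma one_sub_nonneg_of_norm_lt {B : Mat m} (hB : ‖B‖ < 1) : (0 : Mat m) ≤ 1 - Bᴴ * B := by
  rw [sub_nonneg]
  refine (CStarAlgebra.norm_le_one_iff_of_nonneg _ (star_mul_self_nonneg B)).1 ?_
  rw [Matrix.star_eq_conjTranspose, Matrix.l2_opNorm_conjTranspose_mul_self]
  nlinarith [norm_nonneg B]

lemma isUnit_one_sub {B : Mat m} (hB : ‖B‖ < 1) : IsUnit (1 - Bᴴ * B) := by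
  refine isUnit_one_sub_of_norm_lt_one ?_
  rw [Matrix.l2_opNorm_conjTranspose_mul_self]
  nlinarith [norm_nonneg B]

/-- The sequence `α*`. Passing to it exchanges `ρ` and `ρ̃`, and turns each block `Θ_k` into its
adjoint. -/
def adj (α : ℤ → Mat m) (k : ℤ) : Mat m := (α k)ᴴ

lemma norm_adj {α : ℤ → Mat m} (hα : ∀ k, ‖α k‖ < 1) (k : ℤ) : ‖adj α k‖ < 1 := by
  rw [adj, Matrix.l2_opNorm_conjTranspose]; exact hα k

@[simp] lemma adj_adj (α : ℤ → Mat m) : adj (adj α) = α := by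
  funext k; simp [adj]

lemma rho_adj (α : ℤ → Mat m) (k : ℤ) : rho (adj α) k = rhoT α k := by
  simp [rho, rhoT, adj]

lemma rhoT_adj (α : ℤ → Mat m) (k : ℤ) : rhoT (adj α) k = rho α k := by
  simp [rho, rhoT, adj]

lemma rho_mul_self {α : ℤ → Mat m} (hα : ∀ k, ‖α k‖ < 1) (k : ℤ) :
    rho α k * rho α k = 1 - (α k)ᴴ * α k :=
  CFC.sqrt_mul_sqrt_self _ (one_sub_nonneg_of_norm_lt (hα k))

lemma rhoT_mul_self {α : ℤ → Mat m} (hα : ∀ k, ‖α k‖ < 1) (k : ℤ) :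
    rhoT α k * rhoT α k = 1 - α k * (α k)ᴴ := by
  simpa [rho_adj, adj] using rho_mul_self (norm_adj hα) k

lemma rho_conjTranspose (α : ℤ → Mat m) (k : ℤ) : (rho α k)ᴴ = rho α k :=
  (CFC.sqrt_nonneg _).isSelfAdjoint

lemma rhoT_conjTranspose (α : ℤ → Mat m) (k : ℤ) : (rhoT α k)ᴴ = rhoT α k :=
  (CFC.sqrt_nonneg _).isSelfAdjoint

lemma isUnit_rho {α : ℤ → Mat m} (hα : ∀ k, ‖α k‖ < 1) (k : ℤ) : IsUnit (rho α k) := by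
  have h := isUnit_one_sub (hα k)
  rw [← rho_mul_self hα k] at h
  exact isUnit_of_mul_isUnit_left h

lemma isUnit_rhoT {α : ℤ → Mat m} (hα : ∀ k, ‖α k‖ < 1) (k : ℤ) : IsUnit (rhoT α k) := by
  rw [← rho_adj]; exact isUnit_rho (norm_adj hα) k

open scoped ComplexOrder in
/-- The homogeneous Sylvester equation `S X + X R = 0` with `S, R ≥ 0` and `S` invertible has only
the zero solution: the traces of `X* S X` and `X* X R` are nonnegative and add up to zero. -/
lemma eq_zero_of_sylvester {S R X : Mat m} (hS : 0 ≤ S) (hR : 0 ≤ R) (hu : IsUnit S)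
    (h : S * X + X * R = 0) : X = 0 := by
  obtain ⟨s, hs, hs'⟩ : ∃ s : Mat m, s * s = S ∧ sᴴ = s :=
    ⟨CFC.sqrt S, CFC.sqrt_mul_sqrt_self _ hS, (CFC.sqrt_nonneg _).isSelfAdjoint⟩
  obtain ⟨r, hr, hr'⟩ : ∃ r : Mat m, r * r = R ∧ rᴴ = r :=
    ⟨CFC.sqrt R, CFC.sqrt_mul_sqrt_self _ hR, (CFC.sqrt_nonneg _).isSelfAdjoint⟩
  have h1 : ((s * X)ᴴ * (s * X)).trace + ((X * r)ᴴ * (X * r)).trace = 0 := by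
    have e1 : (s * X)ᴴ * (s * X) = Xᴴ * (S * X) := by
      rw [Matrix.conjTranspose_mul, hs', ← hs]; simp only [mul_assoc]
    have e2 : ((X * r)ᴴ * (X * r)).trace = (Xᴴ * (X * R)).trace := by
      rw [Matrix.conjTranspose_mul, hr', ← hr, mul_assoc, Matrix.trace_mul_comm]
      simp only [mul_assoc]
    rw [e1, e2, ← Matrix.trace_add, ← mul_add, h, mul_zero, Matrix.trace_zero]
  have nn : ∀ A : Mat m, 0 ≤ (Aᴴ * A).trace := fun A =>
    (Matrix.posSemidef_conjTranspose_mul_self A).trace_nonneg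
  have h2 : ((s * X)ᴴ * (s * X)).trace = 0 :=
    ((add_eq_zero_iff_of_nonneg (nn _) (nn _)).1 h1).1
  have h3 : s * X = 0 := Matrix.trace_conjTranspose_mul_self_eq_zero_iff.1 h2
  refine hu.mul_left_cancel ?_
  rw [← hs, mul_assoc, h3, mul_zero, mul_zero]

/-- The defect matrices intertwine `α`. -/
lemma mul_rho {α : ℤ → Mat m} (hα : ∀ k, ‖α k‖ < 1) (k : ℤ) :
    α k * rho α k = rhoT α k * α k := by
  rw [← sub_eq_zero]
  refine eq_zero_of_sylvester (S := rhoT α k) (R := rho α k) (CFC.sqrt_nonneg _)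
    (CFC.sqrt_nonneg _) (isUnit_rhoT hα k) ?_
  have e : rhoT α k * (α k * rho α k - rhoT α k * α k) +
      (α k * rho α k - rhoT α k * α k) * rho α k =
      α k * (rho α k * rho α k) - rhoT α k * rhoT α k * α k := by noncomm_ring
  rw [e, rho_mul_self hα, rhoT_mul_self hα]
  noncomm_ring

lemma conjTranspose_mul_rhoT {α : ℤ → Mat m} (hα : ∀ k, ‖α k‖ < 1) (k : ℤ) :
    (α k)ᴴ * rhoT α k = rho α k * (α k)ᴴ := by
  simpa [rho_adj, rhoT_adj, adj] using mul_rho (norm_adj hα) k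

/-! ### The action of matrices on vectors -/

lemma act_add_left (A B : Mat m) (x : Vec m) : act (A + B) x = act A x + act B x := by
  simp [act]

lemma act_sub_left (A B : Mat m) (x : Vec m) : act (A - B) x = act A x - act B x := by
  simp [act]

lemma act_neg_left (A : Mat m) (x : Vec m) : act (-A) x = -act A x := by
  simp [act]

lemma act_smul_left (c : ℂ) (A : Mat m) (x : Vec m) : act (c • A) x = c • act A x := by
  simp [act]

lemma act_mul (A B : Mat m) (x : Vec m) : act (A * B) x = act A (act B x) := by
  simp [act]

@[simp] lemma act_one (x : Vec m) : act (1 : Mat m) x = x := by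
  simp [act]

lemma act_add (A : Mat m) (x y : Vec m) : act A (x + y) = act A x + act A y := map_add _ _ _

lemma act_sub (A : Mat m) (x y : Vec m) : act A (x - y) = act A x - act A y := map_sub _ _ _

lemma act_neg (A : Mat m) (x : Vec m) : act A (-x) = -act A x := map_neg _ _

lemma act_smul (A : Mat m) (c : ℂ) (x : Vec m) : act A (c • x) = c • act A x := map_smul _ _ _

@[simp] lemma act_zero (A : Mat m) : act A (0 : Vec m) = 0 := map_zero _

lemma act_injective {A B : Mat m} (h : ∀ x, act A x = act B x) : A = B :=
  (Matrix.toEuclideanCLM (𝕜 := ℂ) (n := Fin m)).injective (ContinuousLinearMap.ext h)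

lemma isUnit_of_act {A : Mat m} (h : ∀ x, act A x = 0 → x = 0) : IsUnit A := by
  have hinj : Function.Injective (Matrix.toEuclideanCLM (𝕜 := ℂ) A).toLinearMap := by
    rw [← LinearMap.ker_eq_bot, LinearMap.ker_eq_bot']
    exact h
  rw [← Matrix.mulVec_injective_iff_isUnit]
  intro x y hxy
  have : (WithLp.toLp 2 x : Vec m) = WithLp.toLp 2 y := by
    apply hinj
    simp [Matrix.toEuclideanCLM_toLp, hxy]
  simpa using this

lemma act_eq_zero_iff {A : Mat m} (hA : IsUnit A) {x : Vec m} : act A x = 0 ↔ x = 0 := by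
  refine ⟨fun h => ?_, fun h => by simp [h]⟩
  obtain ⟨u, rfl⟩ := hA
  rw [← act_one x, ← u.inv_mul, act_mul, h, act_zero]

lemma inner_act_act (A B : Mat m) (x y : Vec m) :
    inner ℂ (act A x) (act B y) = inner ℂ x (act (Aᴴ * B) y) := by
  have h : Matrix.toEuclideanCLM (𝕜 := ℂ) Aᴴ =
      ContinuousLinearMap.adjoint (Matrix.toEuclideanCLM (𝕜 := ℂ) A) :=
    map_star (Matrix.toEuclideanCLM (𝕜 := ℂ) (n := Fin m)) A
  rw [act_mul]
  simp only [act]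
  rw [h, ContinuousLinearMap.adjoint_inner_right]

/-- A matrix is bounded by the sum of the norms of its columns. -/
lemma norm_le_sum_act (A : Mat m) :
    ‖A‖ ≤ ∑ j, ‖act A (EuclideanSpace.single j (1 : ℂ))‖ := by
  rw [Matrix.cstar_norm_def]
  refine ContinuousLinearMap.opNorm_le_bound _ (Finset.sum_nonneg fun _ _ => norm_nonneg _) ?_
  intro x
  have hx : x = ∑ j, x j • EuclideanSpace.single j (1 : ℂ) := by
    ext i; simp [Finset.sum_apply, Pi.single_apply]
  have h : (Matrix.toEuclideanCLM (𝕜 := ℂ) A) x =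
      ∑ j, x j • act A (EuclideanSpace.single j (1 : ℂ)) := by
    conv_lhs => rw [hx]
    simp [act]
  rw [h, Finset.sum_mul]
  refine (norm_sum_le _ _).trans (Finset.sum_le_sum fun j _ => ?_)
  rw [norm_smul, mul_comm]
  exact mul_le_mul_of_nonneg_left (PiLp.norm_apply_le x j) (norm_nonneg _)

/-- The matrix with columns `f j`. -/
noncomputable def ofCols (f : Fin m → Vec m) : Mat m := Matrix.of fun i j => f j i

lemma act_ofCols (f : Fin m → Vec m) (j : Fin m) :
    act (ofCols f) (EuclideanSpace.single j (1 : ℂ)) = f j := by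
  ext i
  simp [act, ofCols, EuclideanSpace.single]

/-! ### Unitarity of the CMV operator -/

/-- Each block `Θ_k` preserves the Euclidean norm. -/
lemma norm_block_sq {α : ℤ → Mat m} (hα : ∀ k, ‖α k‖ < 1) (k : ℤ) (x y : Vec m) :
    ‖act (-α k) x + act (rhoT α k) y‖ ^ 2 + ‖act (rho α k) x + act (α k)ᴴ y‖ ^ 2 =
      ‖x‖ ^ 2 + ‖y‖ ^ 2 := by
  have key : inner ℂ (act (-α k) x + act (rhoT α k) y) (act (-α k) x + act (rhoT α k) y) +
      inner ℂ (act (rho α k) x + act (α k)ᴴ y) (act (rho α k) x + act (α k)ᴴ y) =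
      inner ℂ x x + inner ℂ y y := by
    simp only [inner_add_left, inner_add_right, inner_act_act, rho_conjTranspose,
      rhoT_conjTranspose, Matrix.conjTranspose_conjTranspose, rho_mul_self hα, rhoT_mul_self hα,
      conjTranspose_mul_rhoT hα, ← mul_rho hα, act_neg_left, act_sub_left, act_one,
      inner_neg_left, inner_neg_right, inner_sub_right]
    ring
  rw [inner_self_eq_norm_sq_to_K, inner_self_eq_norm_sq_to_K, inner_self_eq_norm_sq_to_K,
    inner_self_eq_norm_sq_to_K] at key
  exact_mod_cast key

section Block

variable {p : ℤ → Prop} [DecidablePred p]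

lemma blockExpr_of_pos {α : ℤ → Mat m} {φ : ℤ → Vec m} {k : ℤ} (hk : p k) :
    blockExpr p α φ k = act (rho α k) (φ (k - 1)) + act (α k)ᴴ (φ k) := by
  simp [blockExpr, hk]

lemma blockExpr_of_neg {α : ℤ → Mat m} {φ : ℤ → Vec m} {k : ℤ} (hk : ¬ p k) :
    blockExpr p α φ k = act (-α (k + 1)) (φ k) + act (rhoT α (k + 1)) (φ (k + 1)) := by
  simp [blockExpr, hk]

lemma blockExpr_sub_one (hp : ∀ k, p (k + 1) ↔ ¬ p k) {α : ℤ → Mat m} {φ : ℤ → Vec m} {k : ℤ}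
    (hk : p k) :
    blockExpr p α φ (k - 1) = act (-α k) (φ (k - 1)) + act (rhoT α k) (φ k) := by
  have : ¬ p (k - 1) := by rw [← hp]; simpa using hk
  simp [blockExpr_of_neg this]

lemma blockExpr_add (α : ℤ → Mat m) (φ ψ : ℤ → Vec m) (k : ℤ) :
    blockExpr p α (fun j => φ j + ψ j) k = blockExpr p α φ k + blockExpr p α ψ k := by
  simp only [blockExpr, act_add]
  split_ifs <;> abel

lemma blockExpr_sub (α : ℤ → Mat m) (φ ψ : ℤ → Vec m) (k : ℤ) :
    blockExpr p α (fun j => φ j - ψ j) k = blockExpr p α φ k - blockExpr p α ψ k := by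
  simp only [blockExpr, act_sub]
  split_ifs <;> abel

lemma blockExpr_smul (α : ℤ → Mat m) (c : ℂ) (φ : ℤ → Vec m) (k : ℤ) :
    blockExpr p α (fun j => c • φ j) k = c • blockExpr p α φ k := by
  simp only [blockExpr, act_smul]
  split_ifs <;> rw [smul_add]

/-- The block expression of `α*` is a left inverse of that of `α`. -/
lemma blockExpr_adj_blockExpr (hp : ∀ k, p (k + 1) ↔ ¬ p k) {α : ℤ → Mat m}
    (hα : ∀ k, ‖α k‖ < 1) (φ : ℤ → Vec m) (k : ℤ) :
    blockExpr p (adj α) (blockExpr p α φ) k = φ k := by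
  by_cases hk : p k
  · rw [blockExpr_of_pos hk, blockExpr_sub_one hp hk, blockExpr_of_pos hk, rho_adj, adj,
      Matrix.conjTranspose_conjTranspose]
    simp only [act_add, ← act_mul, mul_rho hα, act_neg_left, act_neg,
      rhoT_mul_self hα, act_sub_left, act_one]
    abel
  · have hk' : p (k + 1) := (hp k).2 hk
    rw [blockExpr_of_neg hk, blockExpr_of_neg hk, blockExpr_of_pos hk', rhoT_adj, adj]
    simp only [act_add, ← act_mul, conjTranspose_mul_rhoT hα, act_neg_left, act_neg,
      neg_mul, rho_mul_self hα, act_sub_left, act_one, add_sub_cancel_right]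
    abel

/-- A summable series over `ℤ` may be summed over the pairs `(k - 1, k)` with `p k`. -/
lemma hasSum_pairs (hp : ∀ k, p (k + 1) ↔ ¬ p k) {f : ℤ → ℝ} {a : ℝ} (hf : HasSum f a) :
    HasSum (fun k => if p k then f (k - 1) + f k else 0) a := by
  have hs : Summable (fun k => if p k then f k else 0) := by
    refine (hf.summable.indicator {k | p k}).congr fun k => ?_
    by_cases hk : p k <;> simp [hk]
  have hs' : Summable (fun k => if p k then 0 else f k) := by
    refine (hf.summable.indicator {k | ¬ p k}).congr fun k => ?_
    by_cases hk : p k <;> simp [hk]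
  have h1 : HasSum (fun k => if p k then f (k - 1) else 0)
      (∑' k, if p k then 0 else f k) := by
    rw [← (Equiv.addRight (1 : ℤ)).hasSum_iff]
    convert hs'.hasSum using 2 with k
    simp [hp, ite_not]
  have h2 := h1.add hs.hasSum
  have h3 : a = (∑' k, if p k then 0 else f k) + ∑' k, if p k then f k else 0 := by
    refine hf.unique ?_
    convert hs'.hasSum.add hs.hasSum using 2 with k
    split_ifs <;> simp
  rw [h3]
  convert h2 using 2 with k
  split_ifs <;> simp

lemma L2.hasSum_norm_sq (φ : L2 m) : HasSum (fun k => ‖φ k‖ ^ 2) (‖φ‖ ^ 2) := by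
  have := lp.hasSum_norm (p := 2) (by norm_num) φ
  simpa using this

lemma blockOp_apply (α : ℤ → Mat m) (hα : ∀ k, ‖α k‖ < 1) (φ : L2 m) (k : ℤ) :
    blockOp p α hα φ k = blockExpr p α φ k := rfl

lemma norm_blockOp (hp : ∀ k, p (k + 1) ↔ ¬ p k) {α : ℤ → Mat m} (hα : ∀ k, ‖α k‖ < 1)
    (φ : L2 m) : ‖blockOp p α hα φ‖ = ‖φ‖ := by
  have h1 := hasSum_pairs hp (L2.hasSum_norm_sq (blockOp p α hα φ))
  have h2 := hasSum_pairs hp (L2.hasSum_norm_sq φ)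
  have h3 : (fun k => if p k then ‖blockOp p α hα φ (k - 1)‖ ^ 2 + ‖blockOp p α hα φ k‖ ^ 2
      else 0) = fun k => if p k then ‖φ (k - 1)‖ ^ 2 + ‖φ k‖ ^ 2 else 0 := by
    funext k
    split_ifs with hk
    · rw [blockOp_apply, blockOp_apply, blockExpr_sub_one hp hk, blockExpr_of_pos hk,
        norm_block_sq hα]
    · rfl
  rw [h3] at h1
  exact (sq_eq_sq₀ (norm_nonneg _) (norm_nonneg _)).1 (h1.unique h2)

lemma blockOp_adj_mul (hp : ∀ k, p (k + 1) ↔ ¬ p k) {α : ℤ → Mat m} (hα : ∀ k, ‖α k‖ < 1) :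
    blockOp p (adj α) (norm_adj hα) * blockOp p α hα = 1 := by
  ext1 φ
  ext1
  funext k
  exact blockExpr_adj_blockExpr hp hα φ k

lemma blockOp_mul_adj (hp : ∀ k, p (k + 1) ↔ ¬ p k) {α : ℤ → Mat m} (hα : ∀ k, ‖α k‖ < 1) :
    blockOp p α hα * blockOp p (adj α) (norm_adj hα) = 1 := by
  have h := blockOp_adj_mul hp (norm_adj hα)
  simpa only [adj_adj] using h

lemma blockOp_mem_unitary (hp : ∀ k, p (k + 1) ↔ ¬ p k) {α : ℤ → Mat m}
    (hα : ∀ k, ‖α k‖ < 1) : blockOp p α hα ∈ unitary (L2 m →L[ℂ] L2 m) := by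
  have h1 : star (blockOp p α hα) * blockOp p α hα = 1 :=
    (ContinuousLinearMap.norm_map_iff_adjoint_comp_self _).1 (norm_blockOp hp hα)
  have h2 : star (blockOp p α hα) = blockOp p (adj α) (norm_adj hα) :=
    left_inv_eq_right_inv h1 (blockOp_mul_adj hp hα)
  exact ⟨h1, by rw [h2, blockOp_mul_adj hp hα]⟩

end Block

lemma even_add_one_iff (k : ℤ) : Even (k + 1) ↔ ¬ Even k := Int.even_add_one

lemma odd_add_one_iff (k : ℤ) : Odd (k + 1) ↔ ¬ Odd k := by
  rw [← Int.not_even_iff_odd, ← Int.not_even_iff_odd, Int.even_add_one]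

lemma opU_mem_unitary {α : ℤ → Mat m} (hα : ∀ k, ‖α k‖ < 1) :
    opU α hα ∈ unitary (L2 m →L[ℂ] L2 m) :=
  mul_mem (blockOp_mem_unitary even_add_one_iff hα) (blockOp_mem_unitary odd_add_one_iff hα)

/-- A unitary operator has its spectrum on the unit circle. -/
lemma isUnit_opU_sub {α : ℤ → Mat m} (hα : ∀ k, ‖α k‖ < 1) {z : ℂ} (hz : ‖z‖ ≠ 1) :
    IsUnit (opU α hα - z • (1 : L2 m →L[ℂ] L2 m)) := by
  have h : z ∉ spectrum ℂ (opU α hα) := fun h => hz <| by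
    simpa using spectrum.subset_circle_of_unitary (opU_mem_unitary hα) h
  rw [spectrum.notMem_iff, ← IsUnit.neg_iff, neg_sub, Algebra.algebraMap_eq_smul_one] at h
  exact h

/-- Surjectivity of `𝕌 - z` in terms of pairs: for square summable `h` the system
`𝕎 ψ = z η`, `𝕍 η = ψ + h` has a square summable solution. -/
lemma exists_pair_of_source {α : ℤ → Mat m} (hα : ∀ k, ‖α k‖ < 1) {z : ℂ} (hz : ‖z‖ ≠ 1)
    (hz0 : z ≠ 0) (h : L2 m) : ∃ ψ η : L2 m, (∀ k, blockExpr Odd α ψ k = z • η k) ∧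
      ∀ k, blockExpr Even α η k = ψ k + h k := by
  obtain ⟨ψ, hψ⟩ : ∃ ψ : L2 m, (opU α hα - z • (1 : L2 m →L[ℂ] L2 m)) ψ = z • h := by
    obtain ⟨T, hT⟩ := (isUnit_opU_sub hα hz).exists_right_inv
    refine ⟨T (z • h), ?_⟩
    rw [← mul_apply_eq_comp, hT]; rfl
  refine ⟨ψ, z⁻¹ • opW α hα ψ, fun k => ?_, fun k => ?_⟩
  · change _ = z • (z⁻¹ • blockExpr Odd α ψ k)
    rw [smul_smul, mul_inv_cancel₀ hz0, one_smul]
  · have h1 : opV α hα (opW α hα ψ) k - z • ψ k = z • h k := by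
      exact congrArg (fun φ : L2 m => φ k) hψ
    have h2 : blockExpr Even α (z⁻¹ • opW α hα ψ : L2 m) k = z⁻¹ • opV α hα (opW α hα ψ) k :=
      blockExpr_smul α z⁻¹ _ k
    rw [h2, sub_eq_iff_eq_add.1 h1, ← smul_add, smul_smul, inv_mul_cancel₀ hz0, one_smul, add_comm]

/-! ### Solutions of the transfer recursion -/

/-- A vector solution `(u, v)` of the eigenvalue problem, written as the first order system
`𝕎 u = z v`, `𝕍 v = u`, so that `𝕌 u = z u` as a difference expression. -/
structure IsSol (α : ℤ → Mat m) (z : ℂ) (u v : ℤ → Vec m) : Prop where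
  odd_eq : ∀ k, blockExpr Odd α u k = z • v k
  even_eq : ∀ k, blockExpr Even α v k = u k

namespace IsSol

variable {α : ℤ → Mat m} {z : ℂ} {u v u' v' : ℤ → Vec m}

lemma add (h : IsSol α z u v) (h' : IsSol α z u' v') :
    IsSol α z (fun k => u k + u' k) (fun k => v k + v' k) where
  odd_eq k := by rw [blockExpr_add, h.odd_eq, h'.odd_eq, smul_add]
  even_eq k := by rw [blockExpr_add, h.even_eq, h'.even_eq]

lemma sub (h : IsSol α z u v) (h' : IsSol α z u' v') :
    IsSol α z (fun k => u k - u' k) (fun k => v k - v' k) where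
  odd_eq k := by rw [blockExpr_sub, h.odd_eq, h'.odd_eq, smul_sub]
  even_eq k := by rw [blockExpr_sub, h.even_eq, h'.even_eq]

lemma odd_fst (h : IsSol α z u v) {k : ℤ} (hk : Odd k) :
    act (-α k) (u (k - 1)) + act (rhoT α k) (u k) = z • v (k - 1) := by
  rw [← blockExpr_sub_one odd_add_one_iff hk, h.odd_eq]

lemma odd_snd (h : IsSol α z u v) {k : ℤ} (hk : Odd k) :
    act (rho α k) (u (k - 1)) + act (α k)ᴴ (u k) = z • v k := by
  rw [← blockExpr_of_pos hk, h.odd_eq]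

lemma even_fst (h : IsSol α z u v) {k : ℤ} (hk : Even k) :
    act (-α k) (v (k - 1)) + act (rhoT α k) (v k) = u (k - 1) := by
  rw [← blockExpr_sub_one even_add_one_iff hk, h.even_eq]

lemma even_snd (h : IsSol α z u v) {k : ℤ} (hk : Even k) :
    act (rho α k) (v (k - 1)) + act (α k)ᴴ (v k) = u k := by
  rw [← blockExpr_of_pos hk, h.even_eq]

lemma zero_sub_one (hα : ∀ k, ‖α k‖ < 1) (hz : z ≠ 0) (h : IsSol α z u v) {k : ℤ}
    (hk : u k = 0 ∧ v k = 0) : u (k - 1) = 0 ∧ v (k - 1) = 0 := by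
  rcases Int.even_or_odd k with he | ho
  · have h1 := h.even_snd he
    rw [hk.1, hk.2, act_zero, add_zero, act_eq_zero_iff (isUnit_rho hα k)] at h1
    have h2 := h.even_fst he
    rw [h1, hk.2, act_zero, act_zero, add_zero] at h2
    exact ⟨h2.symm, h1⟩
  · have h1 := h.odd_snd ho
    rw [hk.1, hk.2, act_zero, add_zero, smul_zero, act_eq_zero_iff (isUnit_rho hα k)] at h1
    have h2 := h.odd_fst ho
    rw [h1, hk.1, act_zero, act_zero, add_zero, eq_comm, smul_eq_zero] at h2
    exact ⟨h1, h2.resolve_left hz⟩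

lemma zero_add_one (hα : ∀ k, ‖α k‖ < 1) (hz : z ≠ 0) (h : IsSol α z u v) {k : ℤ}
    (hk : u k = 0 ∧ v k = 0) : u (k + 1) = 0 ∧ v (k + 1) = 0 := by
  rcases Int.even_or_odd (k + 1) with he | ho
  · have h1 := h.even_fst he
    rw [add_sub_cancel_right, hk.1, hk.2, act_zero, zero_add,
      act_eq_zero_iff (isUnit_rhoT hα _)] at h1
    have h2 := h.even_snd he
    rw [h1, add_sub_cancel_right, hk.2, act_zero, act_zero, add_zero] at h2
    exact ⟨h2.symm, h1⟩
  · have h1 := h.odd_fst ho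
    rw [add_sub_cancel_right, hk.1, hk.2, act_zero, zero_add, smul_zero,
      act_eq_zero_iff (isUnit_rhoT hα _)] at h1
    have h2 := h.odd_snd ho
    rw [h1, add_sub_cancel_right, hk.1, act_zero, act_zero, add_zero, eq_comm,
      smul_eq_zero] at h2
    exact ⟨h1, h2.resolve_left hz⟩

/-- A solution that vanishes at one site vanishes everywhere. -/
lemma eq_zero (hα : ∀ k, ‖α k‖ < 1) (hz : z ≠ 0) (h : IsSol α z u v) {k₀ : ℤ}
    (hk : u k₀ = 0 ∧ v k₀ = 0) (k : ℤ) : u k = 0 ∧ v k = 0 := by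
  induction k using Int.inductionOn' (b := k₀) with
  | zero => exact hk
  | succ k _ ih => exact h.zero_add_one hα hz ih
  | pred k _ ih => exact h.zero_sub_one hα hz ih

end IsSol

/-- A pair of matrix-valued sequences each of whose columns is a solution, written out on the
blocks `Θ_k`. -/
structure IsMatSol (α : ℤ → Mat m) (z : ℂ) (U V : ℤ → Mat m) : Prop where
  odd_fst : ∀ k, Odd k → -α k * U (k - 1) + rhoT α k * U k = z • V (k - 1)
  odd_snd : ∀ k, Odd k → rho α k * U (k - 1) + (α k)ᴴ * U k = z • V k
  even_fst : ∀ k, Even k → -α k * V (k - 1) + rhoT α k * V k = U (k - 1)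
  even_snd : ∀ k, Even k → rho α k * V (k - 1) + (α k)ᴴ * V k = U k

namespace IsMatSol

variable {α : ℤ → Mat m} {z : ℂ} {U V U' V' : ℤ → Mat m}

lemma add_mul (h : IsMatSol α z U V) (h' : IsMatSol α z U' V') (M : Mat m) :
    IsMatSol α z (fun k => U k + U' k * M) (fun k => V k + V' k * M) where
  odd_fst k hk := by
    simp only [smul_add, ← smul_mul_assoc, ← h.odd_fst k hk, ← h'.odd_fst k hk]; noncomm_ring
  odd_snd k hk := by
    simp only [smul_add, ← smul_mul_assoc, ← h.odd_snd k hk, ← h'.odd_snd k hk]; noncomm_ring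
  even_fst k hk := by
    simp only [← h.even_fst k hk, ← h'.even_fst k hk]; noncomm_ring
  even_snd k hk := by
    simp only [← h.even_snd k hk, ← h'.even_snd k hk]; noncomm_ring

lemma isSol (h : IsMatSol α z U V) (x : Vec m) :
    IsSol α z (fun k => act (U k) x) (fun k => act (V k) x) where
  odd_eq k := by
    by_cases hk : Odd k
    · rw [blockExpr_of_pos hk, ← act_mul, ← act_mul, ← act_add_left, h.odd_snd k hk,
        act_smul_left]
    · have := h.odd_fst (k + 1) ((odd_add_one_iff k).2 hk)
      rw [add_sub_cancel_right] at this
      rw [blockExpr_of_neg hk, ← act_mul, ← act_mul, ← act_add_left, this, act_smul_left]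
  even_eq k := by
    by_cases hk : Even k
    · rw [blockExpr_of_pos hk, ← act_mul, ← act_mul, ← act_add_left, h.even_snd k hk]
    · have := h.even_fst (k + 1) ((even_add_one_iff k).2 hk)
      rw [add_sub_cancel_right] at this
      rw [blockExpr_of_neg hk, ← act_mul, ← act_mul, ← act_add_left, this]

/-- The second component of a matrix solution is `𝕍*` applied to the first. -/
lemma exprVadj_eq (hα : ∀ k, ‖α k‖ < 1) (h : IsMatSol α z U V) (k : ℤ) :
    exprVadj α U k = V k := by
  unfold exprVadj
  split_ifs with hk
  · rw [← h.even_fst k hk, ← h.even_snd k hk]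
    have e : rhoT α k * (-α k * V (k - 1) + rhoT α k * V k) +
        α k * (rho α k * V (k - 1) + (α k)ᴴ * V k) =
        (α k * rho α k - rhoT α k * α k) * V (k - 1) +
          (rhoT α k * rhoT α k + α k * (α k)ᴴ) * V k := by noncomm_ring
    rw [e, mul_rho hα, rhoT_mul_self hα]
    noncomm_ring
  · have hk' : Even (k + 1) := (even_add_one_iff k).2 hk
    have h1 := h.even_fst _ hk'
    rw [add_sub_cancel_right] at h1
    have h2 := h.even_snd _ hk'
    rw [add_sub_cancel_right] at h2
    rw [← h1, ← h2]
    have e : -(α (k + 1))ᴴ * (-α (k + 1) * V k + rhoT α (k + 1) * V (k + 1)) +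
        rho α (k + 1) * (rho α (k + 1) * V k + (α (k + 1))ᴴ * V (k + 1)) =
        ((α (k + 1))ᴴ * α (k + 1) + rho α (k + 1) * rho α (k + 1)) * V k +
          (rho α (k + 1) * (α (k + 1))ᴴ - (α (k + 1))ᴴ * rhoT α (k + 1)) * V (k + 1) := by
      noncomm_ring
    rw [e, conjTranspose_mul_rhoT hα, rho_mul_self hα]
    noncomm_ring

end IsMatSol

section Transfer

variable {α : ℤ → Mat m}

lemma rho_mul_inv (hα : ∀ k, ‖α k‖ < 1) (k : ℤ) : rho α k * (rho α k)⁻¹ = 1 :=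
  Matrix.mul_nonsing_inv _ ((Matrix.isUnit_iff_isUnit_det _).1 (isUnit_rho hα k))

lemma inv_mul_rho (hα : ∀ k, ‖α k‖ < 1) (k : ℤ) : (rho α k)⁻¹ * rho α k = 1 :=
  Matrix.nonsing_inv_mul _ ((Matrix.isUnit_iff_isUnit_det _).1 (isUnit_rho hα k))

lemma rhoT_mul_inv (hα : ∀ k, ‖α k‖ < 1) (k : ℤ) : rhoT α k * (rhoT α k)⁻¹ = 1 :=
  Matrix.mul_nonsing_inv _ ((Matrix.isUnit_iff_isUnit_det _).1 (isUnit_rhoT hα k))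

lemma inv_mul_rhoT (hα : ∀ k, ‖α k‖ < 1) (k : ℤ) : (rhoT α k)⁻¹ * rhoT α k = 1 :=
  Matrix.nonsing_inv_mul _ ((Matrix.isUnit_iff_isUnit_det _).1 (isUnit_rhoT hα k))

lemma mul_rho_inv (hα : ∀ k, ‖α k‖ < 1) (k : ℤ) :
    α k * (rho α k)⁻¹ = (rhoT α k)⁻¹ * α k := by
  calc α k * (rho α k)⁻¹ = (rhoT α k)⁻¹ * rhoT α k * (α k * (rho α k)⁻¹) := by
        rw [inv_mul_rhoT hα, one_mul]
    _ = (rhoT α k)⁻¹ * (rhoT α k * α k) * (rho α k)⁻¹ := by simp only [mul_assoc]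
    _ = (rhoT α k)⁻¹ * α k * (rho α k * (rho α k)⁻¹) := by
        rw [← mul_rho hα]; simp only [mul_assoc]
    _ = (rhoT α k)⁻¹ * α k := by rw [rho_mul_inv hα, mul_one]

lemma conjTranspose_mul_rhoT_inv (hα : ∀ k, ‖α k‖ < 1) (k : ℤ) :
    (α k)ᴴ * (rhoT α k)⁻¹ = (rho α k)⁻¹ * (α k)ᴴ := by
  simpa [rho_adj, rhoT_adj, adj] using mul_rho_inv (norm_adj hα) k

lemma rho_add (hα : ∀ k, ‖α k‖ < 1) (k : ℤ) :
    rho α k + (rho α k)⁻¹ * ((α k)ᴴ * α k) = (rho α k)⁻¹ := by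
  have h : (α k)ᴴ * α k = 1 - rho α k * rho α k := by rw [rho_mul_self hα]; abel
  rw [h, mul_sub, ← mul_assoc, inv_mul_rho hα]
  simp

lemma rho_inv_mul_self_sub (hα : ∀ k, ‖α k‖ < 1) (k : ℤ) :
    (rho α k)⁻¹ * (rho α k)⁻¹ - (rho α k)⁻¹ * ((rho α k)⁻¹ * ((α k)ᴴ * α k)) = 1 := by
  rw [← mul_sub, sub_eq_of_eq_add (rho_add hα k).symm, inv_mul_rho hα]

/-- Solving `Θ_k (X, X') = (Y, Y')` for the second entries gives the form of the transfer matrix. -/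
lemma block_of_transfer (hα : ∀ k, ‖α k‖ < 1) (k : ℤ) {X Y X' Y' : Mat m}
    (hX : X' = (rhoT α k)⁻¹ * α k * X + (rhoT α k)⁻¹ * Y)
    (hY : Y' = (rho α k)⁻¹ * X + (rho α k)⁻¹ * (α k)ᴴ * Y) :
    -α k * X + rhoT α k * X' = Y ∧ rho α k * X + (α k)ᴴ * X' = Y' := by
  constructor
  · rw [hX, mul_add, ← mul_assoc, ← mul_assoc, ← mul_assoc, rhoT_mul_inv hα]
    noncomm_ring
  · rw [hX, hY, mul_add, ← mul_assoc, ← mul_assoc, ← mul_assoc, conjTranspose_mul_rhoT_inv hα,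
      mul_assoc (rho α k)⁻¹ _ (α k), ← add_assoc, ← Matrix.add_mul, rho_add hα]

lemma isUnit_transfer (hα : ∀ k, ‖α k‖ < 1) {z : ℂ} (hz : z ≠ 0) (k : ℤ) :
    IsUnit (transfer α z k) := by
  have h1 := rho_inv_mul_self_sub hα k
  have h2 := rho_inv_mul_self_sub (norm_adj hα) k
  simp only [rho_adj, adj, Matrix.conjTranspose_conjTranspose] at h2
  have h3 : (rho α k)⁻¹ * (α k)ᴴ * ((rhoT α k)⁻¹ * α k) =
      (rho α k)⁻¹ * ((rho α k)⁻¹ * ((α k)ᴴ * α k)) := by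
    rw [mul_assoc, ← mul_assoc (α k)ᴴ, conjTranspose_mul_rhoT_inv hα, mul_assoc]
  have h4 : (rhoT α k)⁻¹ * α k * ((rho α k)⁻¹ * (α k)ᴴ) =
      (rhoT α k)⁻¹ * ((rhoT α k)⁻¹ * (α k * (α k)ᴴ)) := by
    rw [mul_assoc, ← mul_assoc (α k), mul_rho_inv hα, mul_assoc]
  unfold transfer
  split_ifs with hk
  · refine IsUnit.of_mul_eq_one (Matrix.fromBlocks (-((rho α k)⁻¹ * (α k)ᴴ)) (z • (rho α k)⁻¹)
      (z⁻¹ • (rhoT α k)⁻¹) (-((rhoT α k)⁻¹ * α k))) ?_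
    rw [Matrix.fromBlocks_multiply, ← Matrix.fromBlocks_one]
    congr 1
    · rw [smul_mul_smul_comm, mul_inv_cancel₀ hz, one_smul, mul_neg, h4, neg_add_eq_sub, h2]
    · rw [mul_smul_comm, smul_mul_assoc, mul_assoc, mul_rho_inv hα, mul_neg, smul_neg,
        add_neg_cancel]
    · rw [mul_smul_comm, smul_mul_assoc, mul_assoc _ (α k)ᴴ, conjTranspose_mul_rhoT_inv hα,
        mul_neg, smul_neg, neg_add_cancel]
    · rw [smul_mul_smul_comm, inv_mul_cancel₀ hz, one_smul, mul_neg, h3, ← sub_eq_add_neg, h1]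
  · refine IsUnit.of_mul_eq_one (Matrix.fromBlocks (-((rhoT α k)⁻¹ * α k)) (rhoT α k)⁻¹
      (rho α k)⁻¹ (-((rho α k)⁻¹ * (α k)ᴴ))) ?_
    rw [Matrix.fromBlocks_multiply, ← Matrix.fromBlocks_one]
    congr 1
    · rw [mul_neg, h3, neg_add_eq_sub, h1]
    · rw [mul_assoc, conjTranspose_mul_rhoT_inv hα, mul_neg, add_neg_cancel]
    · rw [mul_assoc _ (α k), mul_rho_inv hα, mul_neg, neg_add_cancel]
    · rw [mul_neg, h4, ← sub_eq_add_neg, h2]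

lemma solution_self (z : ℂ) (k₀ : ℤ) (X : Matrix (Fin m ⊕ Fin m) (Fin m) ℂ) :
    solution α z k₀ X k₀ = X := by
  simp [solution, forward]

lemma solution_step (hα : ∀ k, ‖α k‖ < 1) {z : ℂ} (hz : z ≠ 0) (k₀ : ℤ)
    (X : Matrix (Fin m ⊕ Fin m) (Fin m) ℂ) (k : ℤ) :
    solution α z k₀ X k = transfer α z k * solution α z k₀ X (k - 1) := by
  rcases lt_or_ge k₀ k with h | h
  · obtain ⟨n, rfl⟩ : ∃ n : ℕ, k = k₀ + n + 1 := ⟨(k - k₀ - 1).toNat, by lia⟩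
    have e1 : (k₀ + n + 1 - k₀).toNat = n + 1 := by lia
    have e2 : (k₀ + n + 1 - 1 - k₀).toNat = n := by lia
    rw [solution, solution, if_pos h.le, if_pos (by lia), e1, e2, forward]
  · obtain ⟨n, rfl⟩ : ∃ n : ℕ, k = k₀ - n := ⟨(k₀ - k).toNat, by lia⟩
    have e0 : solution α z k₀ X (k₀ - n) = backward α z k₀ X n := by
      rcases Nat.eq_zero_or_pos n with rfl | hn
      · simp [solution, forward, backward]
      · rw [solution, if_neg (by lia)]
        congr 1; lia
    have e2 : (k₀ - (k₀ - n - 1)).toNat = n + 1 := by lia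
    rw [e0, solution, if_neg (by lia), e2, backward, ← Matrix.mul_assoc, Matrix.mul_nonsing_inv,
      Matrix.one_mul]
    exact (Matrix.isUnit_iff_isUnit_det _).1 (isUnit_transfer hα hz _)

/-- The transfer recursion amounts to the first order system `𝕎 U = z V`, `𝕍 V = U`. -/
lemma isMatSol_solution (hα : ∀ k, ‖α k‖ < 1) {z : ℂ} (hz : z ≠ 0) (k₀ : ℤ)
    (X : Matrix (Fin m ⊕ Fin m) (Fin m) ℂ) :
    IsMatSol α z (fun k => (solution α z k₀ X k).toRows₁)
      (fun k => (solution α z k₀ X k).toRows₂) := by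
  have hodd : ∀ k, Odd k → _ := fun k hk => by
    have h := solution_step hα hz k₀ X k
    rw [transfer, if_pos hk, ← Matrix.fromRows_toRows (solution α z k₀ X (k - 1)),
      Matrix.fromBlocks_mul_fromRows] at h
    refine block_of_transfer hα k (X := (solution α z k₀ X (k - 1)).toRows₁)
      (Y := z • (solution α z k₀ X (k - 1)).toRows₂) (X' := (solution α z k₀ X k).toRows₁)
      (Y' := z • (solution α z k₀ X k).toRows₂) ?_ ?_
    · rw [h, Matrix.toRows₁_fromRows, mul_smul_comm, smul_mul_assoc]
    · rw [h, Matrix.toRows₂_fromRows, smul_add, smul_mul_assoc, smul_smul, mul_inv_cancel₀ hz,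
        one_smul, mul_smul_comm]
  have heven : ∀ k, Even k → _ := fun k hk => by
    have h := solution_step hα hz k₀ X k
    rw [transfer, if_neg (Int.not_odd_iff_even.2 hk),
      ← Matrix.fromRows_toRows (solution α z k₀ X (k - 1)), Matrix.fromBlocks_mul_fromRows] at h
    refine block_of_transfer hα k (X := (solution α z k₀ X (k - 1)).toRows₂)
      (Y := (solution α z k₀ X (k - 1)).toRows₁) (X' := (solution α z k₀ X k).toRows₂)
      (Y' := (solution α z k₀ X k).toRows₁) ?_ ?_
    · rw [h, Matrix.toRows₂_fromRows, add_comm]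
    · rw [h, Matrix.toRows₁_fromRows, add_comm]
  exact ⟨fun k hk => (hodd k hk).1, fun k hk => (hodd k hk).2, fun k hk => (heven k hk).1,
    fun k hk => (heven k hk).2⟩

end Transfer

/-! ### Square summability at one end of the lattice -/

/-- Square summability of `f` at `+∞` (for `ε = 1`) or at `-∞` (for `ε = -1`). -/
def SqSum {E : Type*} [NormedAddCommGroup E] (ε : ℤ) (f : ℤ → E) : Prop :=
  Summable fun n : ℕ => ‖f (ε * n)‖ ^ 2

namespace SqSum

variable {E F : Type*} [NormedAddCommGroup E] [NormedAddCommGroup F] {ε : ℤ}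

lemma mono {f : ℤ → E} {g : ℤ → F} (hf : SqSum ε f) (C : ℝ)
    (h : ∀ n : ℕ, ‖g (ε * n)‖ ≤ C * ‖f (ε * n)‖) : SqSum ε g := by
  refine Summable.of_nonneg_of_le (fun _ => by positivity) (fun n => ?_) (hf.mul_left (C ^ 2))
  rw [← mul_pow]
  exact pow_le_pow_left₀ (norm_nonneg _) (h n) 2

lemma add {f g : ℤ → E} (hf : SqSum ε f) (hg : SqSum ε g) : SqSum ε fun k => f k + g k := by
  refine Summable.of_nonneg_of_le (fun _ => by positivity) (fun n => ?_)
    ((hf.mul_left 2).add (hg.mul_left 2))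
  have h1 := norm_add_le (f (ε * n)) (g (ε * n))
  nlinarith [norm_nonneg (f (ε * n) + g (ε * n)), sq_nonneg (‖f (ε * n)‖ - ‖g (ε * n)‖)]

lemma neg {f : ℤ → E} (hf : SqSum ε f) : SqSum ε fun k => -f k :=
  hf.mono 1 fun n => by simp

lemma sub {f g : ℤ → E} (hf : SqSum ε f) (hg : SqSum ε g) : SqSum ε fun k => f k - g k := by
  simpa only [sub_eq_add_neg] using hf.add hg.neg

lemma congr {f g : ℤ → E} (hf : SqSum ε f) (h : ∀ᶠ n : ℕ in Filter.atTop, g (ε * n) = f (ε * n)) :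
    SqSum ε g := by
  refine (summable_congr_cofinite ?_).1 hf
  rw [Nat.cofinite_eq_atTop]
  filter_upwards [h] with n hn
  rw [hn]

lemma tendsto {f : ℤ → E} (hf : SqSum ε f) :
    Filter.Tendsto (fun n : ℕ => ‖f (ε * n)‖) Filter.atTop (nhds 0) := by
  have h := (Summable.tendsto_atTop_zero hf).sqrt
  simpa [Real.sqrt_sq] using h

lemma zero : SqSum ε fun _ => (0 : E) := by simp [SqSum]

lemma of_lp (hε : ε = 1 ∨ ε = -1) (φ : L2 m) : SqSum ε φ := by
  refine (L2.hasSum_norm_sq φ).summable.comp_injective (i := fun n : ℕ => ε * (n : ℤ)) ?_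
  intro a b hab
  rcases hε with rfl | rfl <;> simpa using hab

lemma act {f : ℤ → Mat m} (hf : SqSum ε f) (x : Vec m) : SqSum ε fun k => act (f k) x :=
  hf.mono ‖x‖ fun _ => (norm_act_le _ _).trans_eq (mul_comm _ _)

lemma of_act {f : ℤ → Mat m}
    (hf : ∀ j, SqSum ε fun k => CMV.act (f k) (EuclideanSpace.single j (1 : ℂ))) : SqSum ε f := by
  have h : ∀ s : Finset (Fin m), SqSum ε fun k =>
      ∑ j ∈ s, ‖CMV.act (f k) (EuclideanSpace.single j (1 : ℂ))‖ := by
    intro s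
    induction s using Finset.induction_on with
    | empty => simpa using zero (E := ℝ)
    | insert a s ha ih =>
      simp only [Finset.sum_insert ha]
      exact ((hf a).mono 1 fun n => by simp).add ih
  refine (h Finset.univ).mono 1 fun n => ?_
  rw [one_mul]
  exact (norm_le_sum_act _).trans (Real.le_norm_self _)

/-- A sequence on `ℤ` that is square summable at both ends belongs to `ℓ²(ℤ)`. -/
lemma memℓp {f : ℤ → Vec m} (h1 : SqSum 1 f) (h2 : SqSum (-1) f) :
    Memℓp f 2 := by
  refine (memℓp_gen_iff (by norm_num)).2 ?_
  have h : Summable fun k => ‖f k‖ ^ 2 :=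
    Summable.of_nat_of_neg (by simpa [SqSum] using h1) (by simpa [SqSum] using h2)
  simpa using h

end SqSum

lemma summable_shift_iff {ε : ℤ} (hε : ε * ε = 1) (h : ℤ → ℝ) (k₀ : ℤ) :
    (Summable fun n : ℕ => h (k₀ + ε * n)) ↔ Summable fun n : ℕ => h (ε * n) := by
  have hb : (ε * k₀).toNat - (-(ε * k₀)).toNat = ε * k₀ := by lia
  rw [← summable_nat_add_iff (-(ε * k₀)).toNat,
    ← summable_nat_add_iff (f := fun n : ℕ => h (ε * n)) (ε * k₀).toNat]
  refine summable_congr fun n => congrArg h ?_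
  push_cast
  linear_combination (-ε) * hb - k₀ * hε

lemma memℓp_Ici_iff {E : Type*} [NormedAddCommGroup E] (f : ℤ → E) (k₀ : ℤ) :
    Memℓp (fun k : Set.Ici k₀ => f k) 2 ↔ SqSum 1 f := by
  let e : ℕ ≃ Set.Ici k₀ :=
    { toFun := fun n => ⟨k₀ + 1 * n, by simp⟩
      invFun := fun k => (k.1 - k₀).toNat
      left_inv := fun n => by simp
      right_inv := fun ⟨k, hk⟩ => by
        ext
        have : k₀ ≤ k := hk
        simp [this] }
  rw [memℓp_gen_iff (by norm_num), ← e.summable_iff, SqSum,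
    ← summable_shift_iff (by norm_num) (fun k => ‖f k‖ ^ 2) k₀]
  simp [e, Function.comp_def]

lemma memℓp_Iic_iff {E : Type*} [NormedAddCommGroup E] (f : ℤ → E) (k₀ : ℤ) :
    Memℓp (fun k : Set.Iic k₀ => f k) 2 ↔ SqSum (-1) f := by
  let e : ℕ ≃ Set.Iic k₀ :=
    { toFun := fun n => ⟨k₀ + -1 * n, by simp⟩
      invFun := fun k => (k₀ - k.1).toNat
      left_inv := fun n => by simp
      right_inv := fun ⟨k, hk⟩ => by
        ext
        have : k ≤ k₀ := hk
        simp [this] }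
  rw [memℓp_gen_iff (by norm_num), ← e.summable_iff, SqSum,
    ← summable_shift_iff (by norm_num) (fun k => ‖f k‖ ^ 2) k₀]
  simp [e, Function.comp_def]

/-! ### The monotone energy of a solution -/

/-- The normalized energy `± (‖u‖² - ‖v‖²) / (|z|² - 1)` of a solution, with the sign `+` at odd
and `-` at even sites. It is nondecreasing along `ℤ`. -/
noncomputable def energy (z : ℂ) (u v : ℤ → Vec m) (k : ℤ) : ℝ :=
  (if Odd k then ‖u k‖ ^ 2 - ‖v k‖ ^ 2 else ‖v k‖ ^ 2 - ‖u k‖ ^ 2) / (‖z‖ ^ 2 - 1)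

lemma norm_sq_sub_one_ne_zero {z : ℂ} (hz : ‖z‖ ≠ 1) : ‖z‖ ^ 2 - 1 ≠ 0 := by
  intro h
  exact hz ((sq_eq_sq₀ (norm_nonneg _) zero_le_one).1 (by linarith))

namespace IsSol

variable {α : ℤ → Mat m} {z : ℂ} {u v : ℤ → Vec m}

lemma energy_of_odd (hα : ∀ k, ‖α k‖ < 1) (hz : ‖z‖ ≠ 1) (h : IsSol α z u v) {k : ℤ}
    (hk : Odd k) : energy z u v k = energy z u v (k - 1) + (‖v (k - 1)‖ ^ 2 + ‖v k‖ ^ 2) := by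
  have hk' : ¬ Odd (k - 1) := by rw [← odd_add_one_iff]; simpa using hk
  have h1 := norm_block_sq hα k (u (k - 1)) (u k)
  rw [h.odd_fst hk, h.odd_snd hk, norm_smul, norm_smul] at h1
  have hs := norm_sq_sub_one_ne_zero hz
  rw [energy, energy, if_pos hk, if_neg hk']
  field_simp
  linear_combination -h1

lemma energy_of_even (hα : ∀ k, ‖α k‖ < 1) (h : IsSol α z u v) {k : ℤ}
    (hk : Even k) : energy z u v k = energy z u v (k - 1) := by
  have hk' : Odd (k - 1) := by
    rw [← Int.not_even_iff_odd, ← even_add_one_iff]; simpa using hk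
  have h1 := norm_block_sq hα k (v (k - 1)) (v k)
  rw [h.even_fst hk, h.even_snd hk] at h1
  rw [energy, energy, if_neg (Int.not_odd_iff_even.2 hk), if_pos hk']
  congr 1
  linear_combination -h1

lemma energy_mono (hα : ∀ k, ‖α k‖ < 1) (hz : ‖z‖ ≠ 1) (h : IsSol α z u v) :
    Monotone (energy z u v) := by
  refine monotone_int_of_le_succ fun k => ?_
  rcases Int.even_or_odd (k + 1) with he | ho
  · rw [h.energy_of_even hα he, add_sub_cancel_right]
  · rw [h.energy_of_odd hα hz ho, add_sub_cancel_right]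
    have : 0 ≤ ‖v k‖ ^ 2 + ‖v (k + 1)‖ ^ 2 := by positivity
    linarith

lemma energy_tendsto {ε : ℤ} (hu : SqSum ε u) (hv : SqSum ε v) :
    Filter.Tendsto (fun n : ℕ => energy z u v (ε * n)) Filter.atTop (nhds 0) := by
  have h1 : Filter.Tendsto (fun n : ℕ => (‖u (ε * n)‖ ^ 2 + ‖v (ε * n)‖ ^ 2) *
      |(‖z‖ ^ 2 - 1)⁻¹|) Filter.atTop (nhds 0) := by
    simpa using ((hu.tendsto.pow 2).add (hv.tendsto.pow 2)).mul_const |(‖z‖ ^ 2 - 1)⁻¹|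
  refine squeeze_zero_norm (fun n => ?_) h1
  rw [energy, div_eq_mul_inv, norm_mul, Real.norm_eq_abs, Real.norm_eq_abs]
  refine mul_le_mul_of_nonneg_right ?_ (abs_nonneg _)
  have := sq_nonneg ‖u (ε * n)‖
  have := sq_nonneg ‖v (ε * n)‖
  split_ifs <;> rw [abs_le] <;> constructor <;> linarith

lemma energy_nonpos (hα : ∀ k, ‖α k‖ < 1) (hz : ‖z‖ ≠ 1) (h : IsSol α z u v)
    (hu : SqSum 1 u) (hv : SqSum 1 v) (k : ℤ) : energy z u v k ≤ 0 := by
  refine ge_of_tendsto (energy_tendsto (z := z) hu hv) ?_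
  filter_upwards [Filter.eventually_ge_atTop k.toNat] with n hn
  exact h.energy_mono hα hz (by lia)

lemma energy_nonneg (hα : ∀ k, ‖α k‖ < 1) (hz : ‖z‖ ≠ 1) (h : IsSol α z u v)
    (hu : SqSum (-1) u) (hv : SqSum (-1) v) (k : ℤ) : 0 ≤ energy z u v k := by
  refine le_of_tendsto (energy_tendsto (z := z) hu hv) ?_
  filter_upwards [Filter.eventually_ge_atTop (-k).toNat] with n hn
  exact h.energy_mono hα hz (by lia)

/-- If the energy does not increase across an odd block, the solution vanishes: `v` is zero on
the block, and then so is `u`. -/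
lemma eq_zero_of_energy_le (hα : ∀ k, ‖α k‖ < 1) (hz : ‖z‖ ≠ 1) (hz0 : z ≠ 0)
    (h : IsSol α z u v) {k : ℤ} (hk : Odd k) (he : energy z u v k ≤ energy z u v (k - 1))
    (j : ℤ) : u j = 0 ∧ v j = 0 := by
  rw [h.energy_of_odd hα hz hk] at he
  have n1 := sq_nonneg ‖v (k - 1)‖
  have n2 := sq_nonneg ‖v k‖
  have h1 : v (k - 1) = 0 := by
    rw [← norm_eq_zero]; exact pow_eq_zero_iff two_ne_zero |>.1 (by linarith)
  have h2 : v k = 0 := by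
    rw [← norm_eq_zero]; exact pow_eq_zero_iff two_ne_zero |>.1 (by linarith)
  have h3 := norm_block_sq hα k (u (k - 1)) (u k)
  rw [h.odd_fst hk, h.odd_snd hk, h1, h2, smul_zero, norm_zero] at h3
  have n3 := sq_nonneg ‖u (k - 1)‖
  have n4 := sq_nonneg ‖u k‖
  have h4 : u k = 0 := by
    rw [← norm_eq_zero]; exact pow_eq_zero_iff two_ne_zero |>.1 (by linarith)
  exact h.eq_zero hα hz0 ⟨h4, h2⟩ j

lemma eq_zero_of_top (hα : ∀ k, ‖α k‖ < 1) (hz : ‖z‖ ≠ 1) (hz0 : z ≠ 0)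
    (h : IsSol α z u v) (hu : SqSum 1 u) (hv : SqSum 1 v) {k₀ : ℤ}
    (hk : 0 ≤ energy z u v k₀) (j : ℤ) : u j = 0 ∧ v j = 0 := by
  obtain ⟨k, hk₀, hodd⟩ : ∃ k, k₀ < k ∧ Odd k := by
    rcases Int.even_or_odd k₀ with he | ho
    · exact ⟨k₀ + 1, by lia, he.add_one⟩
    · exact ⟨k₀ + 2, by lia, by simpa [Int.odd_add, even_two] using ho⟩
  refine h.eq_zero_of_energy_le hα hz hz0 hodd ?_ j
  exact (h.energy_nonpos hα hz hu hv k).trans (hk.trans (h.energy_mono hα hz (by lia)))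

lemma eq_zero_of_bot (hα : ∀ k, ‖α k‖ < 1) (hz : ‖z‖ ≠ 1) (hz0 : z ≠ 0)
    (h : IsSol α z u v) (hu : SqSum (-1) u) (hv : SqSum (-1) v) {k₀ : ℤ}
    (hk : energy z u v k₀ ≤ 0) (j : ℤ) : u j = 0 ∧ v j = 0 := by
  obtain ⟨k, hk₀, hodd⟩ : ∃ k, k ≤ k₀ ∧ Odd k := by
    rcases Int.even_or_odd k₀ with he | ho
    · exact ⟨k₀ - 1, by lia, he.sub_odd odd_one⟩
    · exact ⟨k₀, le_rfl, ho⟩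
  refine h.eq_zero_of_energy_le hα hz hz0 hodd ?_ j
  exact (h.energy_mono hα hz hk₀).trans (hk.trans (h.energy_nonneg hα hz hu hv _))

/-- There is no square summable solution on all of `ℤ`. -/
lemma eq_zero_of_both (hα : ∀ k, ‖α k‖ < 1) (hz : ‖z‖ ≠ 1) (hz0 : z ≠ 0)
    (h : IsSol α z u v) (hu : SqSum 1 u) (hv : SqSum 1 v) (hu' : SqSum (-1) u)
    (hv' : SqSum (-1) v) (j : ℤ) : u j = 0 ∧ v j = 0 :=
  h.eq_zero_of_bot hα hz hz0 hu' hv' (h.energy_nonpos hα hz hu hv 0) j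

/-- Every solution is the sum of a solution that is square summable at `+∞` and one that is
square summable at `-∞`. Cut the solution off at the left of the block `(-1, 0)`; the error is a
source supported on this block, and the resolvent removes it by a square summable correction. -/
lemma exists_decomposition (hα : ∀ k, ‖α k‖ < 1) (hz : ‖z‖ ≠ 1) (hz0 : z ≠ 0)
    (h : IsSol α z u v) : ∃ ψ η : ℤ → Vec m, IsSol α z ψ η ∧ SqSum (-1) ψ ∧ SqSum (-1) η ∧
      SqSum 1 (fun k => u k - ψ k) ∧ SqSum 1 (fun k => v k - η k) := by
  let φ : ℤ → Vec m := fun k => if 0 ≤ k then u k else 0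
  let χ : ℤ → Vec m := fun k => if 0 ≤ k then v k else 0
  -- The blocks of `𝕎` lie on one side of the cut, so the first equation survives the cutoff.
  have hodd : ∀ k, blockExpr Odd α φ k = z • χ k := by
    intro k
    by_cases hk : Odd k
    · rw [blockExpr_of_pos hk]
      by_cases h0 : 0 ≤ k
      · have h1 : 0 ≤ k - 1 := by
          obtain ⟨j, rfl⟩ := hk; lia
        simp only [φ, χ, if_pos h0, if_pos h1]
        exact h.odd_snd hk
      · have h1 : ¬ 0 ≤ k - 1 := by lia
        simp only [φ, χ, if_neg h0, if_neg h1, act_zero, add_zero, smul_zero]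
    · have hk' := (odd_add_one_iff k).2 hk
      rw [blockExpr_of_neg hk]
      by_cases h0 : 0 ≤ k
      · have h1 : 0 ≤ k + 1 := by lia
        simp only [φ, χ, if_pos h0, if_pos h1]
        simpa using h.odd_fst hk'
      · have h1 : ¬ 0 ≤ k + 1 := by
          obtain ⟨j, hj⟩ := hk'; lia
        simp only [φ, χ, if_neg h0, if_neg h1, act_zero, add_zero, smul_zero]
  have heven : ∀ k, k ≠ 0 → k ≠ -1 → blockExpr Even α χ k = φ k := by
    intro k hk0 hk1
    by_cases hk : Even k
    · rw [blockExpr_of_pos hk]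
      by_cases h0 : 0 ≤ k
      · have h1 : 0 ≤ k - 1 := by lia
        simp only [φ, χ, if_pos h0, if_pos h1]
        exact h.even_snd hk
      · have h1 : ¬ 0 ≤ k - 1 := by lia
        simp only [φ, χ, if_neg h0, if_neg h1, act_zero, add_zero]
    · have hk' := (even_add_one_iff k).2 hk
      rw [blockExpr_of_neg hk]
      by_cases h0 : 0 ≤ k
      · have h1 : 0 ≤ k + 1 := by lia
        simp only [φ, χ, if_pos h0, if_pos h1]
        simpa using h.even_fst hk'
      · have h1 : ¬ 0 ≤ k + 1 := by lia
        simp only [φ, χ, if_neg h0, if_neg h1, act_zero, add_zero]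
  let a : L2 m := lp.single 2 0 (blockExpr Even α χ 0 - φ 0)
  let b : L2 m := lp.single 2 (-1) (blockExpr Even α χ (-1) - φ (-1))
  let s : L2 m := a + b
  have hs : ∀ k, s k = blockExpr Even α χ k - φ k := by
    intro k
    change a k + b k = _
    by_cases h0 : k = 0
    · subst h0; simp [a, b, lp.single_apply]
    · by_cases h1 : k = -1
      · subst h1; simp [a, b, lp.single_apply]
      · simp [a, b, lp.single_apply, h0, h1, heven k h0 h1]
  obtain ⟨ψ, η, hψ, hη⟩ := exists_pair_of_source hα hz hz0 s
  refine ⟨fun k => φ k - ψ k, fun k => χ k - η k, ⟨fun k => ?_, fun k => ?_⟩, ?_, ?_, ?_, ?_⟩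
  · rw [blockExpr_sub, hodd, hψ, smul_sub]
  · rw [blockExpr_sub, hη, hs]; abel
  · refine SqSum.sub (SqSum.zero.congr ?_) (SqSum.of_lp (by simp) ψ)
    filter_upwards [Filter.eventually_gt_atTop 0] with n hn
    exact if_neg (by lia)
  · refine SqSum.sub (SqSum.zero.congr ?_) (SqSum.of_lp (by simp) η)
    filter_upwards [Filter.eventually_gt_atTop 0] with n hn
    exact if_neg (by lia)
  · refine (SqSum.of_lp (by simp) ψ).congr (.of_forall fun n => ?_)
    have : (0 : ℤ) ≤ 1 * n := by lia
    simp only [φ, if_pos this]; abel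
  · refine (SqSum.of_lp (by simp) η).congr (.of_forall fun n => ?_)
    have : (0 : ℤ) ≤ 1 * n := by lia
    simp only [χ, if_pos this]; abel

end IsSol

/-! ### Existence and uniqueness of the Weyl solutions -/

/-- The first component of the solution with coordinates `(y, x)`, namely `Q₊ y + P₊ x`. -/
noncomputable def solU (α : ℤ → Mat m) (g : Mat m) (z : ℂ) (k₀ : ℤ) (p : Vec m × Vec m) (k : ℤ) :
    Vec m :=
  act (solQS α g z k₀ k).toRows₁ p.1 + act (solPR α g z k₀ k).toRows₁ p.2

/-- The second component of the solution with coordinates `(y, x)`, namely `S₊ y + R₊ x`. -/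
noncomputable def solV (α : ℤ → Mat m) (g : Mat m) (z : ℂ) (k₀ : ℤ) (p : Vec m × Vec m) (k : ℤ) :
    Vec m :=
  act (solQS α g z k₀ k).toRows₂ p.1 + act (solPR α g z k₀ k).toRows₂ p.2

section Param

variable {α : ℤ → Mat m} {g : Mat m} {z : ℂ} {k₀ : ℤ}

lemma isMatSol_comb (hα : ∀ k, ‖α k‖ < 1) (hz0 : z ≠ 0) (M : Mat m) :
    IsMatSol α z (combU α g z k₀ M) (combV α g z k₀ M) :=
  (isMatSol_solution hα hz0 k₀ _).add_mul (isMatSol_solution hα hz0 k₀ _) M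

lemma isSol_sol (hα : ∀ k, ‖α k‖ < 1) (hz0 : z ≠ 0) (p : Vec m × Vec m) :
    IsSol α z (solU α g z k₀ p) (solV α g z k₀ p) :=
  ((isMatSol_solution hα hz0 k₀ _).isSol p.1).add ((isMatSol_solution hα hz0 k₀ _).isSol p.2)

lemma act_combU (M : Mat m) (x : Vec m) (k : ℤ) :
    act (combU α g z k₀ M k) x = solU α g z k₀ (x, act M x) k := by
  rw [combU, act_add_left, act_mul, solU]

lemma act_combV (M : Mat m) (x : Vec m) (k : ℤ) :
    act (combV α g z k₀ M k) x = solV α g z k₀ (x, act M x) k := by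
  rw [combV, act_add_left, act_mul, solV]

lemma solU_add (p q : Vec m × Vec m) (k : ℤ) :
    solU α g z k₀ (p + q) k = solU α g z k₀ p k + solU α g z k₀ q k := by
  simp only [solU, Prod.fst_add, Prod.snd_add, act_add]; abel

lemma solV_add (p q : Vec m × Vec m) (k : ℤ) :
    solV α g z k₀ (p + q) k = solV α g z k₀ p k + solV α g z k₀ q k := by
  simp only [solV, Prod.fst_add, Prod.snd_add, act_add]; abel

lemma solU_smul (c : ℂ) (p : Vec m × Vec m) (k : ℤ) :
    solU α g z k₀ (c • p) k = c • solU α g z k₀ p k := by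
  simp only [solU, Prod.smul_fst, Prod.smul_snd, act_smul, smul_add]

lemma solV_smul (c : ℂ) (p : Vec m × Vec m) (k : ℤ) :
    solV α g z k₀ (c • p) k = c • solV α g z k₀ p k := by
  simp only [solV, Prod.smul_fst, Prod.smul_snd, act_smul, smul_add]

lemma solU_sub (p q : Vec m × Vec m) (k : ℤ) :
    solU α g z k₀ (p - q) k = solU α g z k₀ p k - solU α g z k₀ q k := by
  simp only [solU, Prod.fst_sub, Prod.snd_sub, act_sub]; abel

lemma solV_sub (p q : Vec m × Vec m) (k : ℤ) :
    solV α g z k₀ (p - q) k = solV α g z k₀ p k - solV α g z k₀ q k := by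
  simp only [solV, Prod.fst_sub, Prod.snd_sub, act_sub]; abel

lemma sol_self_of_odd (hk : Odd k₀) (p : Vec m × Vec m) :
    solU α g z k₀ p k₀ = z • act g (p.1 + p.2) ∧
      solV α g z k₀ p k₀ = act g⁻¹ (p.2 - p.1) := by
  simp only [solU, solV, solQS, solPR, solution_self, if_pos hk, Matrix.toRows₁_fromRows,
    Matrix.toRows₂_fromRows, act_smul_left, act_neg_left, act_add, act_sub, smul_add, true_and]
  abel

lemma sol_self_of_even (hk : Even k₀) (p : Vec m × Vec m) :
    solU α g z k₀ p k₀ = act g⁻¹ (p.2 - p.1) ∧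
      solV α g z k₀ p k₀ = act g (p.1 + p.2) := by
  simp only [solU, solV, solQS, solPR, solution_self, if_neg (Int.not_odd_iff_even.2 hk),
    Matrix.toRows₁_fromRows, Matrix.toRows₂_fromRows, act_neg_left, act_add, act_sub, and_true]
  abel

lemma unitary_mul_conjTranspose (hg : g ∈ Matrix.unitaryGroup (Fin m) ℂ) : g * gᴴ = 1 :=
  Matrix.mem_unitaryGroup_iff.1 hg

lemma unitary_conjTranspose_mul (hg : g ∈ Matrix.unitaryGroup (Fin m) ℂ) : gᴴ * g = 1 :=
  Matrix.mem_unitaryGroup_iff'.1 hg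

lemma unitary_inv (hg : g ∈ Matrix.unitaryGroup (Fin m) ℂ) : g⁻¹ = gᴴ :=
  Matrix.inv_eq_right_inv (unitary_mul_conjTranspose hg)

lemma norm_act_unitary (hg : g ∈ Matrix.unitaryGroup (Fin m) ℂ) (x : Vec m) :
    ‖act g x‖ = ‖x‖ := by
  have h := inner_act_act g g x x
  rw [unitary_conjTranspose_mul hg, act_one, inner_self_eq_norm_sq_to_K,
    inner_self_eq_norm_sq_to_K] at h
  exact (sq_eq_sq₀ (norm_nonneg _) (norm_nonneg _)).1 (by exact_mod_cast h)

lemma norm_act_unitary_inv (hg : g ∈ Matrix.unitaryGroup (Fin m) ℂ) (x : Vec m) :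
    ‖act g⁻¹ x‖ = ‖x‖ := by
  rw [← norm_act_unitary hg, ← act_mul, unitary_inv hg, unitary_mul_conjTranspose hg, act_one]

/-- Every solution is of the form `(Q₊ y + P₊ x, S₊ y + R₊ x)`. -/
lemma exists_sol_eq (hα : ∀ k, ‖α k‖ < 1) (hg : g ∈ Matrix.unitaryGroup (Fin m) ℂ) (hz0 : z ≠ 0)
    {u v : ℤ → Vec m} (h : IsSol α z u v) :
    ∃ p, u = solU α g z k₀ p ∧ v = solV α g z k₀ p := by
  obtain ⟨p, h1, h2⟩ : ∃ p, u k₀ = solU α g z k₀ p k₀ ∧ v k₀ = solV α g z k₀ p k₀ := by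
    have key : ∀ a b : Vec m, ∃ p : Vec m × Vec m,
        act g (p.1 + p.2) = a ∧ act g⁻¹ (p.2 - p.1) = b := by
      intro a b
      refine ⟨((2⁻¹ : ℂ) • (act gᴴ a - act g b), (2⁻¹ : ℂ) • (act gᴴ a + act g b)), ?_, ?_⟩
      · have : (2⁻¹ : ℂ) • (act gᴴ a - act g b) + (2⁻¹ : ℂ) • (act gᴴ a + act g b) =
            act gᴴ a := by module
        rw [this, ← act_mul, unitary_mul_conjTranspose hg, act_one]
      · have : (2⁻¹ : ℂ) • (act gᴴ a + act g b) - (2⁻¹ : ℂ) • (act gᴴ a - act g b) =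
            act g b := by module
        rw [this, ← act_mul, unitary_inv hg, unitary_conjTranspose_mul hg, act_one]
    rcases Int.even_or_odd k₀ with he | ho
    · obtain ⟨p, hp1, hp2⟩ := key (v k₀) (u k₀)
      exact ⟨p, by rw [(sol_self_of_even he p).1, hp2], by rw [(sol_self_of_even he p).2, hp1]⟩
    · obtain ⟨p, hp1, hp2⟩ := key (z⁻¹ • u k₀) (v k₀)
      refine ⟨p, ?_, by rw [(sol_self_of_odd ho p).2, hp2]⟩
      rw [(sol_self_of_odd ho p).1, hp1, smul_smul, mul_inv_cancel₀ hz0, one_smul]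
  have h3 := (h.sub (isSol_sol (g := g) (k₀ := k₀) hα hz0 p)).eq_zero hα hz0 (k₀ := k₀)
    ⟨sub_eq_zero.2 h1, sub_eq_zero.2 h2⟩
  exact ⟨p, funext fun k => sub_eq_zero.1 (h3 k).1, funext fun k => sub_eq_zero.1 (h3 k).2⟩

/-- The coordinates `(y, x)` of the zero solution vanish. -/
lemma eq_zero_of_sol_self (hg : g ∈ Matrix.unitaryGroup (Fin m) ℂ) (hz0 : z ≠ 0)
    {p : Vec m × Vec m} (hu : solU α g z k₀ p k₀ = 0) (hv : solV α g z k₀ p k₀ = 0) : p = 0 := by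
  have key : p.1 + p.2 = 0 ∧ p.2 - p.1 = 0 := by
    rcases Int.even_or_odd k₀ with he | ho
    · rw [(sol_self_of_even he p).1, ← norm_eq_zero, norm_act_unitary_inv hg, norm_eq_zero] at hu
      rw [(sol_self_of_even he p).2, ← norm_eq_zero, norm_act_unitary hg, norm_eq_zero] at hv
      exact ⟨hv, hu⟩
    · rw [(sol_self_of_odd ho p).1, smul_eq_zero, or_iff_right hz0, ← norm_eq_zero,
        norm_act_unitary hg, norm_eq_zero] at hu
      rw [(sol_self_of_odd ho p).2, ← norm_eq_zero, norm_act_unitary_inv hg, norm_eq_zero] at hv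
      exact ⟨hu, hv⟩
  have h1 : p.2 = p.1 := sub_eq_zero.1 key.2
  have h2 : p.1 = 0 := by
    have := key.1
    rw [h1, ← two_smul ℂ, smul_eq_zero] at this
    exact this.resolve_left two_ne_zero
  exact Prod.ext h2 (h1.trans h2)

/-- The coordinates of the solutions that are square summable at the end `ε`. -/
def sqSol (α : ℤ → Mat m) (g : Mat m) (z : ℂ) (k₀ ε : ℤ) : Submodule ℂ (Vec m × Vec m) where
  carrier := {p | SqSum ε (solU α g z k₀ p) ∧ SqSum ε (solV α g z k₀ p)}
  zero_mem' := by
    have hU : ∀ k, solU α g z k₀ 0 k = 0 := fun k => by simp [solU]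
    have hV : ∀ k, solV α g z k₀ 0 k = 0 := fun k => by simp [solV]
    exact ⟨SqSum.zero.congr (.of_forall fun n => hU _), SqSum.zero.congr (.of_forall fun n => hV _)⟩
  add_mem' := fun {p q} hp hq =>
    ⟨(hp.1.add hq.1).congr (.of_forall fun n => solU_add p q _),
      (hp.2.add hq.2).congr (.of_forall fun n => solV_add p q _)⟩
  smul_mem' := fun c p hp =>
    ⟨hp.1.mono ‖c‖ fun n => by rw [solU_smul, norm_smul],
      hp.2.mono ‖c‖ fun n => by rw [solV_smul, norm_smul]⟩

/-- The solutions `(P₊ x, R₊ x)` have nonnegative energy at `k₀`, so for `x ≠ 0` they are not square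
summable at `+∞`. Their energy at `k₀`, respectively at `k₀ - 1`, is nonpositive if `k₀` is even,
respectively odd, so they are not square summable at `-∞` either. -/
lemma eq_zero_of_mem_sqSol (hα : ∀ k, ‖α k‖ < 1) (hg : g ∈ Matrix.unitaryGroup (Fin m) ℂ)
    (hz : ‖z‖ ≠ 1) (hz0 : z ≠ 0) {ε : ℤ} (hε : ε = 1 ∨ ε = -1) {x : Vec m}
    (h : (0, x) ∈ sqSol α g z k₀ ε) : x = 0 := by
  have hsol := isSol_sol (g := g) (k₀ := k₀) hα hz0 (0, x)
  have hvan : ∀ j, solU α g z k₀ (0, x) j = 0 ∧ solV α g z k₀ (0, x) j = 0 := by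
    have hs := norm_sq_sub_one_ne_zero hz
    rcases Int.even_or_odd k₀ with he | ho
    · have e0 : energy z (solU α g z k₀ (0, x)) (solV α g z k₀ (0, x)) k₀ = 0 := by
        rw [energy, if_neg (Int.not_odd_iff_even.2 he), (sol_self_of_even he _).1,
          (sol_self_of_even he _).2]
        simp [norm_act_unitary hg, norm_act_unitary_inv hg]
      rcases hε with rfl | rfl
      · exact hsol.eq_zero_of_top hα hz hz0 h.1 h.2 e0.ge
      · exact hsol.eq_zero_of_bot hα hz hz0 h.1 h.2 e0.le
    · have e0 : energy z (solU α g z k₀ (0, x)) (solV α g z k₀ (0, x)) k₀ = ‖x‖ ^ 2 := by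
        rw [energy, if_pos ho, (sol_self_of_odd ho _).1, (sol_self_of_odd ho _).2, div_eq_iff hs]
        simp only [zero_add, sub_zero, norm_smul, norm_act_unitary hg, norm_act_unitary_inv hg]
        ring
      rcases hε with rfl | rfl
      · exact hsol.eq_zero_of_top hα hz hz0 h.1 h.2 (e0 ▸ sq_nonneg _)
      · refine hsol.eq_zero_of_bot hα hz hz0 h.1 h.2 (k₀ := k₀ - 1) ?_
        have h1 := hsol.energy_of_odd hα hz ho
        have h2 : ‖solV α g z k₀ (0, x) k₀‖ = ‖x‖ := by
          rw [(sol_self_of_odd ho _).2, norm_act_unitary_inv hg, sub_zero]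
        rw [e0, h2] at h1
        nlinarith [sq_nonneg ‖solV α g z k₀ (0, x) (k₀ - 1)‖]
  exact congrArg Prod.snd (eq_zero_of_sol_self hg hz0 (hvan k₀).1 (hvan k₀).2)

lemma sqSol_sup (hα : ∀ k, ‖α k‖ < 1) (hg : g ∈ Matrix.unitaryGroup (Fin m) ℂ)
    (hz : ‖z‖ ≠ 1) (hz0 : z ≠ 0) : sqSol α g z k₀ 1 ⊔ sqSol α g z k₀ (-1) = ⊤ := by
  rw [eq_top_iff]
  intro p _
  obtain ⟨ψ, η, hsol, h1, h2, h3, h4⟩ :=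
    (isSol_sol (g := g) (k₀ := k₀) hα hz0 p).exists_decomposition hα hz hz0
  obtain ⟨q, rfl, rfl⟩ := exists_sol_eq (g := g) (k₀ := k₀) hα hg hz0 hsol
  refine Submodule.mem_sup.2 ⟨p - q, ⟨?_, ?_⟩, q, ⟨h1, h2⟩, sub_add_cancel p q⟩
  · exact h3.congr (.of_forall fun n => solU_sub p q _)
  · exact h4.congr (.of_forall fun n => solV_sub p q _)

/-- If two subspaces `S`, `T` of `V × V` span it and both meet `0 × V` trivially, then `S` is the
graph of a map: both have dimension at most `dim V`, hence exactly `dim V`. -/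
lemma exists_mem_of_sup_eq_top {V : Type*} [AddCommGroup V] [Module ℂ V] [FiniteDimensional ℂ V]
    {S T : Submodule ℂ (V × V)} (hST : S ⊔ T = ⊤) (hS : ∀ x, (0, x) ∈ S → x = 0)
    (hT : ∀ x, (0, x) ∈ T → x = 0) (y : V) : ∃ x, (y, x) ∈ S := by
  have inj : ∀ R : Submodule ℂ (V × V), (∀ x, (0, x) ∈ R → x = 0) →
      Function.Injective ((LinearMap.fst ℂ V V).comp R.subtype) := by
    intro R hR
    rw [← LinearMap.ker_eq_bot, LinearMap.ker_eq_bot']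
    rintro ⟨⟨a, b⟩, hab⟩ h
    obtain rfl : a = 0 := h
    obtain rfl := hR b hab
    rfl
  have h1 := LinearMap.finrank_le_finrank_of_injective (inj S hS)
  have h2 := LinearMap.finrank_le_finrank_of_injective (inj T hT)
  have h3 := Submodule.finrank_add_le_finrank_add_finrank S T
  rw [hST, finrank_top, Module.finrank_prod] at h3
  have h4 : Module.finrank ℂ S = Module.finrank ℂ V := by lia
  obtain ⟨⟨⟨a, b⟩, hab⟩, h⟩ :=
    (LinearMap.injective_iff_surjective_of_finrank_eq_finrank h4).1 (inj S hS) y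
  obtain rfl : a = y := h
  exact ⟨b, hab⟩

/-- `M` is a Weyl matrix at the end `ε`. -/
def IsWeylAt (ε : ℤ) (α : ℤ → Mat m) (g : Mat m) (z : ℂ) (k₀ : ℤ) (M : Mat m) : Prop :=
  SqSum ε (combU α g z k₀ M) ∧ SqSum ε (combV α g z k₀ M)

lemma isWeyl_Ici_iff (M : Mat m) :
    IsWeyl (Set.Ici k₀) α g z k₀ M ↔ IsWeylAt 1 α g z k₀ M :=
  and_congr (memℓp_Ici_iff _ k₀) (memℓp_Ici_iff _ k₀)

lemma isWeyl_Iic_iff (M : Mat m) :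
    IsWeyl (Set.Iic k₀) α g z k₀ M ↔ IsWeylAt (-1) α g z k₀ M :=
  and_congr (memℓp_Iic_iff _ k₀) (memℓp_Iic_iff _ k₀)

lemma IsWeylAt.mem_sqSol {ε : ℤ} {M : Mat m} (h : IsWeylAt ε α g z k₀ M) (x : Vec m) :
    (x, act M x) ∈ sqSol α g z k₀ ε :=
  ⟨(h.1.act x).congr (.of_forall fun _ => (act_combU M x _).symm),
    (h.2.act x).congr (.of_forall fun _ => (act_combV M x _).symm)⟩

lemma IsWeylAt.unique (hα : ∀ k, ‖α k‖ < 1) (hg : g ∈ Matrix.unitaryGroup (Fin m) ℂ)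
    (hz : ‖z‖ ≠ 1) (hz0 : z ≠ 0) {ε : ℤ} (hε : ε = 1 ∨ ε = -1) {M M' : Mat m}
    (h : IsWeylAt ε α g z k₀ M) (h' : IsWeylAt ε α g z k₀ M') : M = M' := by
  refine act_injective fun x => sub_eq_zero.1 (eq_zero_of_mem_sqSol (k₀ := k₀) hα hg hz hz0 hε ?_)
  simpa using sub_mem (h.mem_sqSol x) (h'.mem_sqSol x)

/-- The Weyl matrix at either end exists and is unique. -/
lemma existsUnique_isWeylAt (hα : ∀ k, ‖α k‖ < 1) (hg : g ∈ Matrix.unitaryGroup (Fin m) ℂ)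
    (hz : ‖z‖ ≠ 1) (hz0 : z ≠ 0) {ε : ℤ} (hε : ε = 1 ∨ ε = -1) :
    ∃! M : Mat m, IsWeylAt ε α g z k₀ M := by
  have hex : ∀ y, ∃ x, (y, x) ∈ sqSol α g z k₀ ε := by
    have h1 := fun x => eq_zero_of_mem_sqSol (k₀ := k₀) hα hg hz hz0 (.inl rfl) (x := x)
    have h2 := fun x => eq_zero_of_mem_sqSol (k₀ := k₀) hα hg hz hz0 (.inr rfl) (x := x)
    have h3 := sqSol_sup (k₀ := k₀) hα hg hz hz0
    rcases hε with rfl | rfl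
    · exact exists_mem_of_sup_eq_top h3 h1 h2
    · exact exists_mem_of_sup_eq_top ((sup_comm _ _).trans h3) h2 h1
  choose f hf using hex
  have h : IsWeylAt ε α g z k₀ (ofCols fun j => f (EuclideanSpace.single j 1)) := by
    constructor <;> refine SqSum.of_act fun j => ?_
    · refine (hf (EuclideanSpace.single j 1)).1.congr (.of_forall fun n => ?_)
      rw [act_combU, act_ofCols]
    · refine (hf (EuclideanSpace.single j 1)).2.congr (.of_forall fun n => ?_)
      rw [act_combV, act_ofCols]
  exact ⟨_, h, fun M hM => hM.unique hα hg hz hz0 hε h⟩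

lemma isWeylAt_Mplus (hα : ∀ k, ‖α k‖ < 1) (hg : g ∈ Matrix.unitaryGroup (Fin m) ℂ)
    (hz : ‖z‖ ≠ 1) (hz0 : z ≠ 0) : IsWeylAt 1 α g z k₀ (Mplus α g z k₀) := by
  obtain ⟨M, hM, -⟩ := existsUnique_isWeylAt (k₀ := k₀) hα hg hz hz0 (.inl rfl)
  rw [← isWeyl_Ici_iff]
  exact Classical.epsilon_spec (p := fun M => IsWeyl (Set.Ici k₀) α g z k₀ M)
    ⟨M, (isWeyl_Ici_iff M).2 hM⟩

lemma isWeylAt_Mminus (hα : ∀ k, ‖α k‖ < 1) (hg : g ∈ Matrix.unitaryGroup (Fin m) ℂ)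
    (hz : ‖z‖ ≠ 1) (hz0 : z ≠ 0) : IsWeylAt (-1) α g z k₀ (Mminus α g z k₀) := by
  obtain ⟨M, hM, -⟩ := existsUnique_isWeylAt (k₀ := k₀) hα hg hz hz0 (.inr rfl)
  rw [← isWeyl_Iic_iff]
  exact Classical.epsilon_spec (p := fun M => IsWeyl (Set.Iic k₀) α g z k₀ M)
    ⟨M, (isWeyl_Iic_iff M).2 hM⟩

/-- A vector in the kernel of `M₊ - M₋` yields a solution that is square summable on `ℤ`. -/
lemma isUnit_weylW (hα : ∀ k, ‖α k‖ < 1) (hg : g ∈ Matrix.unitaryGroup (Fin m) ℂ)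
    (hz : ‖z‖ ≠ 1) (hz0 : z ≠ 0) : IsUnit (weylW α g z k₀) := by
  refine isUnit_of_act fun x hx => ?_
  rw [weylW, act_sub_left, sub_eq_zero] at hx
  have h1 := (isWeylAt_Mplus (k₀ := k₀) hα hg hz hz0).mem_sqSol x
  have h2 := (isWeylAt_Mminus (k₀ := k₀) hα hg hz hz0).mem_sqSol x
  rw [← hx] at h2
  have h3 := (isSol_sol hα hz0 _).eq_zero_of_both hα hz hz0 h1.1 h1.2 h2.1 h2.2 k₀
  exact congrArg Prod.fst (eq_zero_of_sol_self hg hz0 h3.1 h3.2)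

end Param

/-! ### Wronskians -/

section Wronskian

variable {α : ℤ → Mat m} {z z' : ℂ} {U V U' V' : ℤ → Mat m}

/-- Each block `Θ_k` preserves the matrix-valued inner product. -/
lemma block_conjTranspose_mul (hα : ∀ k, ‖α k‖ < 1) (k : ℤ) (X Y X' Y' : Mat m) :
    (-α k * X' + rhoT α k * Y')ᴴ * (-α k * X + rhoT α k * Y) +
      (rho α k * X' + (α k)ᴴ * Y')ᴴ * (rho α k * X + (α k)ᴴ * Y) = X'ᴴ * X + Y'ᴴ * Y := by
  simp only [Matrix.conjTranspose_add, Matrix.conjTranspose_mul, Matrix.conjTranspose_neg,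
    Matrix.conjTranspose_conjTranspose, rho_conjTranspose, rhoT_conjTranspose]
  have e : (X'ᴴ * -(α k)ᴴ + Y'ᴴ * rhoT α k) * (-α k * X + rhoT α k * Y) +
      (X'ᴴ * rho α k + Y'ᴴ * α k) * (rho α k * X + (α k)ᴴ * Y) =
      X'ᴴ * ((α k)ᴴ * α k + rho α k * rho α k) * X +
      X'ᴴ * (rho α k * (α k)ᴴ - (α k)ᴴ * rhoT α k) * Y +
      Y'ᴴ * (α k * rho α k - rhoT α k * α k) * X +
      Y'ᴴ * (rhoT α k * rhoT α k + α k * (α k)ᴴ) * Y := by noncomm_ring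
  rw [e, rho_mul_self hα, rhoT_mul_self hα, mul_rho hα, conjTranspose_mul_rhoT hα]
  noncomm_ring

namespace IsMatSol

lemma wronskian_eq (hα : ∀ k, ‖α k‖ < 1) (h' : IsMatSol α z' U' V') (h : IsMatSol α z U V)
    (k : ℤ) : wronskian α U' U k =
      ((-1 : ℂ) ^ (k + 1) / 2) • ((U' k)ᴴ * U k - (V' k)ᴴ * V k) := by
  rw [wronskian, h.exprVadj_eq hα, h'.exprVadj_eq hα]

lemma wronskian_step (hα : ∀ k, ‖α k‖ < 1) (h' : IsMatSol α z' U' V') (h : IsMatSol α z U V)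
    (hz : conj z' * z = 1) (k : ℤ) : wronskian α U' U k = wronskian α U' U (k - 1) := by
  have key : (U' k)ᴴ * U k - (V' k)ᴴ * V k =
      -((U' (k - 1))ᴴ * U (k - 1) - (V' (k - 1))ᴴ * V (k - 1)) := by
    rcases Int.even_or_odd k with hk | hk
    · have := block_conjTranspose_mul hα k (V (k - 1)) (V k) (V' (k - 1)) (V' k)
      rw [h.even_fst k hk, h.even_snd k hk, h'.even_fst k hk, h'.even_snd k hk] at this
      rw [eq_sub_of_add_eq' this]
      abel
    · have := block_conjTranspose_mul hα k (U (k - 1)) (U k) (U' (k - 1)) (U' k)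
      rw [h.odd_fst k hk, h.odd_snd k hk, h'.odd_fst k hk, h'.odd_snd k hk,
        Matrix.conjTranspose_smul, Matrix.conjTranspose_smul, smul_mul_smul_comm,
        smul_mul_smul_comm, Complex.star_def, hz, one_smul, one_smul] at this
      rw [eq_sub_of_add_eq' this]
      abel
  rw [h'.wronskian_eq hα h, h'.wronskian_eq hα h, key, smul_neg, ← neg_smul, sub_add_cancel,
    zpow_add_one₀ (by norm_num)]
  congr 1
  ring

/-- The Wronskian of a solution at `1 / z̄` and one at `z` is constant. -/
lemma wronskian_const (hα : ∀ k, ‖α k‖ < 1) (h' : IsMatSol α z' U' V') (h : IsMatSol α z U V)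
    (hz : conj z' * z = 1) (k j : ℤ) : wronskian α U' U k = wronskian α U' U j := by
  induction k using Int.inductionOn' (b := j) with
  | zero => rfl
  | succ k _ ih => rw [h'.wronskian_step hα h hz, add_sub_cancel_right, ih]
  | pred k _ ih => rw [← h'.wronskian_step hα h hz, ih]

lemma wronskian_eq_zero (hα : ∀ k, ‖α k‖ < 1) (h' : IsMatSol α z' U' V') (h : IsMatSol α z U V)
    (hz : conj z' * z = 1) {ε : ℤ} (hU' : SqSum ε U') (hV' : SqSum ε V') (hU : SqSum ε U)
    (hV : SqSum ε V) (k : ℤ) : wronskian α U' U k = 0 := by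
  have h1 : Filter.Tendsto (fun n : ℕ => ‖U' (ε * n)‖ * ‖U (ε * n)‖ +
      ‖V' (ε * n)‖ * ‖V (ε * n)‖) Filter.atTop (nhds 0) := by
    simpa using (hU'.tendsto.mul hU.tendsto).add (hV'.tendsto.mul hV.tendsto)
  have h2 : Filter.Tendsto (fun n : ℕ => wronskian α U' U (ε * n)) Filter.atTop (nhds 0) := by
    refine squeeze_zero_norm (fun n => ?_) h1
    rw [h'.wronskian_eq hα h, norm_smul, norm_div, norm_zpow, norm_neg, norm_one, one_zpow]
    have a1 : ‖(U' (ε * n))ᴴ * U (ε * n)‖ ≤ ‖U' (ε * n)‖ * ‖U (ε * n)‖ :=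
      (norm_mul_le _ _).trans_eq (by rw [Matrix.l2_opNorm_conjTranspose])
    have a2 : ‖(V' (ε * n))ᴴ * V (ε * n)‖ ≤ ‖V' (ε * n)‖ * ‖V (ε * n)‖ :=
      (norm_mul_le _ _).trans_eq (by rw [Matrix.l2_opNorm_conjTranspose])
    have a3 := norm_sub_le ((U' (ε * n))ᴴ * U (ε * n)) ((V' (ε * n))ᴴ * V (ε * n))
    have a4 := norm_nonneg ((U' (ε * n))ᴴ * U (ε * n) - (V' (ε * n))ᴴ * V (ε * n))
    have a5 : (1 : ℝ) / ‖(2 : ℂ)‖ = 1 / 2 := by norm_num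
    rw [a5]
    linarith
  have h3 : (fun n : ℕ => wronskian α U' U (ε * n)) = fun _ => wronskian α U' U k :=
    funext fun n => h'.wronskian_const hα h hz _ _
  rw [h3] at h2
  exact tendsto_nhds_unique tendsto_const_nhds h2

end IsMatSol

end Wronskian

section Weyl

variable {α : ℤ → Mat m} {g : Mat m} {z : ℂ} {k₀ : ℤ}

lemma conj_inv_conj_mul (hz0 : z ≠ 0) : conj (1 / conj z) * z = 1 := by
  simp [hz0]

lemma norm_one_div_conj (hz : ‖z‖ ≠ 1) : ‖1 / conj z‖ ≠ 1 := by
  simpa using hz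

lemma one_div_conj_ne_zero (hz0 : z ≠ 0) : 1 / conj z ≠ 0 := by
  simpa using hz0

/-- The Wronskian in terms of the matrices, from the values at `k₀`. -/
lemma wronskian_comb (hα : ∀ k, ‖α k‖ < 1) (hg : g ∈ Matrix.unitaryGroup (Fin m) ℂ)
    (hz0 : z ≠ 0) (M' M : Mat m) (k : ℤ) :
    wronskian α (combU α g (1 / conj z) k₀ M') (combU α g z k₀ M) k = M'ᴴ + M := by
  have h' := isMatSol_comb (g := g) (k₀ := k₀) hα (one_div_conj_ne_zero hz0) M'
  have h := isMatSol_comb (g := g) (k₀ := k₀) hα hz0 M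
  rw [h'.wronskian_const hα h (conj_inv_conj_mul hz0) k k₀, h'.wronskian_eq hα h]
  have g1 : ∀ A B : Mat m, (g * A)ᴴ * (g * B) = Aᴴ * B := fun A B => by
    rw [Matrix.conjTranspose_mul, mul_assoc, ← mul_assoc gᴴ, unitary_conjTranspose_mul hg, one_mul]
  have g2 : ∀ A B : Mat m, (gᴴ * A)ᴴ * (gᴴ * B) = Aᴴ * B := fun A B => by
    rw [Matrix.conjTranspose_mul, mul_assoc, ← mul_assoc gᴴᴴ, Matrix.conjTranspose_conjTranspose,
      unitary_mul_conjTranspose hg, one_mul]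
  have e1 : (1 + M')ᴴ * (1 + M) - (M' - 1)ᴴ * (M - 1) = (2 : ℂ) • (M'ᴴ + M) := by
    simp only [Matrix.conjTranspose_add, Matrix.conjTranspose_sub, Matrix.conjTranspose_one,
      two_smul]
    noncomm_ring
  rcases Int.even_or_odd k₀ with hk | hk
  · have v : ∀ (w : ℂ) (N : Mat m), combU α g w k₀ N k₀ = gᴴ * (N - 1) ∧
        combV α g w k₀ N k₀ = g * (1 + N) := fun w N => by
      simp only [combU, combV, solQS, solPR, solution_self, if_neg (Int.not_odd_iff_even.2 hk),
        Matrix.toRows₁_fromRows, Matrix.toRows₂_fromRows, unitary_inv hg]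
      exact ⟨by noncomm_ring, by noncomm_ring⟩
    rw [(v _ _).1, (v _ _).1, (v _ _).2, (v _ _).2, g1, g2, ← neg_sub, e1, hk.add_one.neg_one_zpow,
      smul_neg, smul_smul, neg_div, neg_mul, div_mul_cancel₀ _ two_ne_zero, neg_smul, neg_neg,
      one_smul]
  · have v : ∀ (w : ℂ) (N : Mat m), combU α g w k₀ N k₀ = w • (g * (1 + N)) ∧
        combV α g w k₀ N k₀ = gᴴ * (N - 1) := fun w N => by
      simp only [combU, combV, solQS, solPR, solution_self, if_pos hk,
        Matrix.toRows₁_fromRows, Matrix.toRows₂_fromRows, unitary_inv hg]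
      constructor
      · rw [mul_add, mul_one, smul_add, smul_mul_assoc]
      · noncomm_ring
    rw [(v _ _).1, (v _ _).1, (v _ _).2, (v _ _).2, Matrix.conjTranspose_smul, smul_mul_smul_comm,
      Complex.star_def, conj_inv_conj_mul hz0, one_smul, g1, g2, e1, hk.add_one.neg_one_zpow,
      smul_smul]
    norm_num

/-- The Weyl matrices at `1 / z̄` and at `z` are related by `M(1 / z̄)* = -M(z)`, because the
Wronskian of the two Weyl solutions tends to zero. -/
lemma IsWeylAt.conjTranspose_add (hα : ∀ k, ‖α k‖ < 1) (hg : g ∈ Matrix.unitaryGroup (Fin m) ℂ)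
    (hz0 : z ≠ 0) {ε : ℤ} {M' M : Mat m} (h' : IsWeylAt ε α g (1 / conj z) k₀ M')
    (h : IsWeylAt ε α g z k₀ M) : M'ᴴ + M = 0 := by
  rw [← wronskian_comb (k₀ := k₀) hα hg hz0 M' M 0]
  exact (isMatSol_comb hα (one_div_conj_ne_zero hz0) M').wronskian_eq_zero hα
    (isMatSol_comb hα hz0 M) (conj_inv_conj_mul hz0) h'.1 h'.2 h.1 h.2 0

lemma Mplus_symm (hα : ∀ k, ‖α k‖ < 1) (hg : g ∈ Matrix.unitaryGroup (Fin m) ℂ)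
    (hz : ‖z‖ ≠ 1) (hz0 : z ≠ 0) : (Mplus α g (1 / conj z) k₀)ᴴ = -Mplus α g z k₀ :=
  eq_neg_of_add_eq_zero_left <|
    (isWeylAt_Mplus hα hg (norm_one_div_conj hz) (one_div_conj_ne_zero hz0)).conjTranspose_add
      hα hg hz0 (isWeylAt_Mplus hα hg hz hz0)

lemma Mminus_symm (hα : ∀ k, ‖α k‖ < 1) (hg : g ∈ Matrix.unitaryGroup (Fin m) ℂ)
    (hz : ‖z‖ ≠ 1) (hz0 : z ≠ 0) : (Mminus α g (1 / conj z) k₀)ᴴ = -Mminus α g z k₀ :=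
  eq_neg_of_add_eq_zero_left <|
    (isWeylAt_Mminus hα hg (norm_one_div_conj hz) (one_div_conj_ne_zero hz0)).conjTranspose_add
      hα hg hz0 (isWeylAt_Mminus hα hg hz hz0)

lemma weylW_eq_neg_wronskian (hα : ∀ k, ‖α k‖ < 1) (hg : g ∈ Matrix.unitaryGroup (Fin m) ℂ)
    (hz : ‖z‖ ≠ 1) (hz0 : z ≠ 0) (k : ℤ) : weylW α g z k₀ =
      -wronskian α (fun n => Uplus α g (1 / conj z) n k₀) (fun n => Uminus α g z n k₀) k := by
  have h := wronskian_comb (k₀ := k₀) hα hg hz0 (Mplus α g (1 / conj z) k₀) (Mminus α g z k₀) k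
  rw [Mplus_symm hα hg hz hz0] at h
  change _ = -wronskian α (combU α g (1 / conj z) k₀ _) (combU α g z k₀ _) k
  rw [h, weylW]
  abel

/-- If the `J`-Gram matrix of two frames `(A, B; C, D)` and `(A', B'; C', D')` of `ℂᵐ ⊕ ℂᵐ` is
antidiagonal with entries `∓ 2 s W`, then the inverse of the second frame is explicit. -/
lemma frame_inverse {A B C D A' B' C' D' W : Mat m} (hW : IsUnit W) {s : ℂ} (hs : s * s = 1)
    (h11 : A'ᴴ * A - C'ᴴ * C = 0) (h12 : A'ᴴ * B - C'ᴴ * D = -(2 * s) • W)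
    (h21 : B'ᴴ * A - D'ᴴ * C = (2 * s) • W) (h22 : B'ᴴ * B - D'ᴴ * D = 0) :
    A * W⁻¹ * B'ᴴ - B * W⁻¹ * A'ᴴ = (2 * s) • 1 ∧ C * W⁻¹ * B'ᴴ = D * W⁻¹ * A'ᴴ := by
  have hWW : W⁻¹ * W = 1 := Matrix.nonsing_inv_mul _ ((Matrix.isUnit_iff_isUnit_det _).1 hW)
  have hs2 : s / 2 * (2 * s) = 1 := by linear_combination hs
  have key : Matrix.fromBlocks ((s / 2) • (W⁻¹ * B'ᴴ)) (-(s / 2) • (W⁻¹ * D'ᴴ))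
      (-(s / 2) • (W⁻¹ * A'ᴴ)) ((s / 2) • (W⁻¹ * C'ᴴ)) * Matrix.fromBlocks A B C D = 1 := by
    rw [Matrix.fromBlocks_multiply, ← Matrix.fromBlocks_one]
    congr 1
    · have : (s / 2) • (W⁻¹ * B'ᴴ) * A + -(s / 2) • (W⁻¹ * D'ᴴ) * C =
          (s / 2) • (W⁻¹ * (B'ᴴ * A - D'ᴴ * C)) := by
        simp only [smul_mul_assoc, mul_sub, smul_sub, neg_smul, neg_mul, mul_assoc]; abel
      rw [this, h21, mul_smul_comm, hWW, smul_smul, hs2, one_smul]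
    · have : (s / 2) • (W⁻¹ * B'ᴴ) * B + -(s / 2) • (W⁻¹ * D'ᴴ) * D =
          (s / 2) • (W⁻¹ * (B'ᴴ * B - D'ᴴ * D)) := by
        simp only [smul_mul_assoc, mul_sub, smul_sub, neg_smul, neg_mul, mul_assoc]; abel
      rw [this, h22, mul_zero, smul_zero]
    · have : -(s / 2) • (W⁻¹ * A'ᴴ) * A + (s / 2) • (W⁻¹ * C'ᴴ) * C =
          -(s / 2) • (W⁻¹ * (A'ᴴ * A - C'ᴴ * C)) := by
        simp only [smul_mul_assoc, mul_sub, smul_sub, neg_smul, neg_mul, mul_assoc]; abel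
      rw [this, h11, mul_zero, smul_zero]
    · have : -(s / 2) • (W⁻¹ * A'ᴴ) * B + (s / 2) • (W⁻¹ * C'ᴴ) * D =
          -(s / 2) • (W⁻¹ * (A'ᴴ * B - C'ᴴ * D)) := by
        simp only [smul_mul_assoc, mul_sub, smul_sub, neg_smul, neg_mul, mul_assoc]; abel
      rw [this, h12, mul_smul_comm, hWW, smul_smul, neg_mul_neg, hs2, one_smul]
  have key2 := mul_eq_one_comm.1 key
  rw [Matrix.fromBlocks_multiply, ← Matrix.fromBlocks_one, Matrix.fromBlocks_inj] at key2
  obtain ⟨k1, -, k2, -⟩ := key2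
  simp only [mul_smul_comm, neg_smul, ← smul_neg, mul_neg, ← smul_add, ← mul_assoc,
    ← sub_eq_add_neg] at k1 k2
  have hs0 : s / 2 ≠ 0 := fun h => by simp [h] at hs2
  constructor
  · rw [← k1, smul_smul, mul_comm, hs2, one_smul]
  · exact sub_eq_zero.1 ((smul_eq_zero.1 k2).resolve_left hs0)

/-- The jump of the two branches of the Green's function on the diagonal. -/
lemma weyl_jump (hα : ∀ k, ‖α k‖ < 1) (hg : g ∈ Matrix.unitaryGroup (Fin m) ℂ)
    (hz : ‖z‖ ≠ 1) (hz0 : z ≠ 0) (k : ℤ) :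
    Uplus α g z k k₀ * (weylW α g z k₀)⁻¹ * (Uminus α g (1 / conj z) k k₀)ᴴ -
      Uminus α g z k k₀ * (weylW α g z k₀)⁻¹ * (Uplus α g (1 / conj z) k k₀)ᴴ =
        (2 * (-1 : ℂ) ^ (k + 1)) • 1 ∧
    combV α g z k₀ (Mplus α g z k₀) k * (weylW α g z k₀)⁻¹ * (Uminus α g (1 / conj z) k k₀)ᴴ =
      combV α g z k₀ (Mminus α g z k₀) k * (weylW α g z k₀)⁻¹ *
        (Uplus α g (1 / conj z) k k₀)ᴴ := by
  have hs : (-1 : ℂ) ^ (k + 1) * (-1 : ℂ) ^ (k + 1) = 1 := by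
    rw [← mul_zpow]; simp
  have gram : ∀ M' M : Mat m,
      (combU α g (1 / conj z) k₀ M' k)ᴴ * combU α g z k₀ M k -
        (combV α g (1 / conj z) k₀ M' k)ᴴ * combV α g z k₀ M k =
      (2 * (-1 : ℂ) ^ (k + 1)) • (M'ᴴ + M) := by
    intro M' M
    rw [← wronskian_comb (k₀ := k₀) hα hg hz0 M' M k,
      (isMatSol_comb hα (one_div_conj_ne_zero hz0) M').wronskian_eq hα (isMatSol_comb hα hz0 M),
      smul_smul]
    have : 2 * (-1 : ℂ) ^ (k + 1) * ((-1 : ℂ) ^ (k + 1) / 2) = 1 := by linear_combination hs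
    rw [this, one_smul]
  refine frame_inverse (C' := combV α g (1 / conj z) k₀ (Mplus α g (1 / conj z) k₀) k)
    (D' := combV α g (1 / conj z) k₀ (Mminus α g (1 / conj z) k₀) k)
    (isUnit_weylW hα hg hz hz0) hs ?_ ?_ ?_ ?_
  · rw [Uplus, Uplus, gram, Mplus_symm hα hg hz hz0, neg_add_cancel, smul_zero]
  · rw [Uplus, Uminus, gram, Mplus_symm hα hg hz hz0, weylW, neg_smul, ← smul_neg]
    congr 1; abel
  · rw [Uplus, Uminus, gram, Mminus_symm hα hg hz hz0, weylW]
    congr 1; abel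
  · rw [Uminus, Uminus, gram, Mminus_symm hα hg hz hz0, neg_add_cancel, smul_zero]

end Weyl

/-! ### The Green's function -/

/-- Gluing two solutions at the site `k'`. If the second components agree at `k'` and the first
ones jump there by `(-1)^{k'+1} c`, the glued pair solves the system with the source `c` at `k'`.
The value of the first component at `k'` is taken from the left if `k'` is odd, and from the right
otherwise, so that no block of `𝕎` straddles the two pieces. -/
lemma IsSol.glue {α : ℤ → Mat m} {z : ℂ} {ul vl ur vr u v : ℤ → Vec m} (hl : IsSol α z ul vl)
    (hr : IsSol α z ur vr) {k' : ℤ} {c : Vec m} (hv : vr k' = vl k')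
    (hu : ur k' - ul k' = (-1 : ℂ) ^ (k' + 1) • c)
    (u_left : ∀ k, k < k' ∨ (k = k' ∧ Odd k) → u k = ul k)
    (u_right : ∀ k, ¬ (k < k' ∨ (k = k' ∧ Odd k)) → u k = ur k)
    (v_left : ∀ k, k ≤ k' → v k = vl k) (v_right : ∀ k, k' ≤ k → v k = vr k) :
    (∀ k, blockExpr Odd α u k = z • v k) ∧
      ∀ k, blockExpr Even α v k = u k + if k = k' then c else 0 := by
  have hodd : ∀ k, Odd k → blockExpr Odd α u (k - 1) = z • v (k - 1) ∧
      blockExpr Odd α u k = z • v k := by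
    intro k hk
    have hk1 : ¬ Odd (k - 1) := by rw [← odd_add_one_iff]; simpa using hk
    rw [blockExpr_sub_one odd_add_one_iff hk, blockExpr_of_pos hk]
    rcases le_or_gt k k' with h | h
    · rw [u_left (k - 1) (.inl (by lia)), v_left (k - 1) (by lia), v_left k h, u_left k
        (h.lt_or_eq.imp id fun e => ⟨e, hk⟩)]
      exact ⟨hl.odd_fst hk, hl.odd_snd hk⟩
    · rw [u_right (k - 1) (by rintro (h' | h'); exacts [by lia, hk1 h'.2]), v_right (k - 1) (by lia),
        v_right k h.le, u_right k (by lia)]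
      exact ⟨hr.odd_fst hk, hr.odd_snd hk⟩
  have heven : ∀ k, Even k →
      blockExpr Even α v (k - 1) = u (k - 1) + (if k - 1 = k' then c else 0) ∧
      blockExpr Even α v k = u k + if k = k' then c else 0 := by
    intro k hk
    have hk1 : Odd (k - 1) := by
      rw [← Int.not_even_iff_odd, ← even_add_one_iff]; simpa using hk
    have hk0 : ¬ Odd k := Int.not_odd_iff_even.2 hk
    rw [blockExpr_sub_one even_add_one_iff hk, blockExpr_of_pos hk]
    rcases le_or_gt k k' with h | h
    · rw [v_left (k - 1) (by lia), v_left k h, u_left (k - 1) (.inl (by lia)), if_neg (by lia),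
        add_zero]
      refine ⟨hl.even_fst hk, ?_⟩
      rw [hl.even_snd hk]
      rcases h.lt_or_eq with h | rfl
      · rw [u_left k (.inl h), if_neg h.ne, add_zero]
      · rw [if_pos rfl, u_right k (by rintro (h' | h'); exacts [lt_irrefl _ h', hk0 h'.2])]
        rw [hk.add_one.neg_one_zpow, neg_one_smul] at hu
        rw [sub_eq_iff_eq_add.1 hu]; abel
    · rw [v_right (k - 1) (by lia), v_right k h.le, u_right k (by lia), if_neg (c := k = k') (by lia),
        add_zero]
      refine ⟨?_, hr.even_snd hk⟩
      rw [hr.even_fst hk]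
      rcases (show k' ≤ k - 1 by lia).lt_or_eq with h | h
      · rw [u_right (k - 1) (by lia), if_neg (by lia), add_zero]
      · rw [if_pos h.symm, u_left (k - 1) (.inr ⟨h.symm, hk1⟩), ← h]
        rw [h, sub_add_cancel, hk.neg_one_zpow, one_smul, ← h] at hu
        rw [sub_eq_iff_eq_add.1 hu]; abel
  refine ⟨fun k => ?_, fun k => ?_⟩
  · by_cases hk : Odd k
    · exact (hodd k hk).2
    · have := (hodd (k + 1) ((odd_add_one_iff k).2 hk)).1
      rwa [add_sub_cancel_right] at this
  · by_cases hk : Even k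
    · exact (heven k hk).2
    · have := (heven (k + 1) ((even_add_one_iff k).2 hk)).1
      rwa [add_sub_cancel_right] at this

section Green

variable {α : ℤ → Mat m} {g : Mat m} {z : ℂ} {k₀ : ℤ}

/-- The columns of the explicit kernel are the columns of the resolvent. -/
lemma exists_green_column (hα : ∀ k, ‖α k‖ < 1) (hg : g ∈ Matrix.unitaryGroup (Fin m) ℂ)
    (hz : ‖z‖ ≠ 1) (hz0 : z ≠ 0) (k' : ℤ) (x : Vec m) :
    ∃ φ : L2 m, (opU α hα - z • (1 : L2 m →L[ℂ] L2 m)) φ = lp.single 2 k' x ∧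
      ∀ k, φ k = act (greenKernel α g k₀ z k k') x := by
  set pl := act ((weylW α g z k₀)⁻¹ * (Uplus α g (1 / conj z) k' k₀)ᴴ) x with hpl
  set pr := act ((weylW α g z k₀)⁻¹ * (Uminus α g (1 / conj z) k' k₀)ᴴ) x with hpr
  have wl := isWeylAt_Mminus (k₀ := k₀) hα hg hz hz0
  have wr := isWeylAt_Mplus (k₀ := k₀) hα hg hz hz0
  have hl := (isMatSol_comb (g := g) (k₀ := k₀) hα hz0 (Mminus α g z k₀)).isSol pl
  have hr := (isMatSol_comb (g := g) (k₀ := k₀) hα hz0 (Mplus α g z k₀)).isSol pr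
  obtain ⟨j1, j2⟩ := weyl_jump (k₀ := k₀) hα hg hz hz0 k'
  -- `u` is the column of the kernel without the factor `1 / (2 z)`, and `v` its companion `𝕎 u / z`.
  let u : ℤ → Vec m := fun k => if k < k' ∨ (k = k' ∧ Odd k) then act (Uminus α g z k k₀) pl
    else act (Uplus α g z k k₀) pr
  let v : ℤ → Vec m := fun k => if k < k' then act (combV α g z k₀ (Mminus α g z k₀) k) pl
    else act (combV α g z k₀ (Mplus α g z k₀) k) pr
  have hv : act (combV α g z k₀ (Mplus α g z k₀) k') pr =
      act (combV α g z k₀ (Mminus α g z k₀) k') pl := by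
    rw [hpl, hpr, ← act_mul, ← act_mul, ← mul_assoc, ← mul_assoc, j2]
  have hu : act (Uplus α g z k' k₀) pr - act (Uminus α g z k' k₀) pl =
      (-1 : ℂ) ^ (k' + 1) • ((2 : ℂ) • x) := by
    rw [hpl, hpr, ← act_mul, ← act_mul, ← mul_assoc, ← mul_assoc, ← act_sub_left, j1,
      act_smul_left, act_one, smul_smul, mul_comm]
  obtain ⟨hW, hV⟩ := hl.glue hr (u := u) (v := v) hv hu (fun k hk => if_pos hk)
    (fun k hk => if_neg hk)
    (fun k hk => by
      rcases hk.lt_or_eq with h | rfl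
      · exact if_pos h
      · rw [← hv]; exact if_neg (lt_irrefl _))
    (fun k hk => if_neg (not_lt.2 hk))
  have hmem : Memℓp u 2 := by
    refine SqSum.memℓp ((wr.1.act pr).congr ?_) ((wl.1.act pl).congr ?_)
    · filter_upwards [Filter.eventually_gt_atTop k'.toNat] with n hn
      exact if_neg (by lia)
    · filter_upwards [Filter.eventually_gt_atTop (-k').toNat] with n hn
      exact if_pos (.inl (by lia))
  let ψ : L2 m := ⟨u, hmem⟩
  have hψ : (opU α hα - z • (1 : L2 m →L[ℂ] L2 m)) ψ = (2 * z) • lp.single 2 k' x := by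
    ext1
    funext k
    change blockExpr Even α (blockExpr Odd α u) k - z • u k =
      (2 * z) • (lp.single (E := fun _ : ℤ => Vec m) 2 k' x) k
    rw [funext hW, blockExpr_smul, hV, lp.single_apply, smul_add, add_sub_cancel_left]
    by_cases hk : k = k'
    · subst hk
      simp [smul_smul, mul_comm]
    · simp [hk]
  have h2z : 2 * z ≠ 0 := mul_ne_zero two_ne_zero hz0
  refine ⟨(1 / (2 * z)) • ψ, ?_, fun k => ?_⟩
  · rw [map_smul, hψ, smul_smul, one_div_mul_cancel h2z, one_smul]
  · change (1 / (2 * z)) • u k = _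
    rw [greenKernel, act_smul_left]
    congr 1
    simp only [u]
    split_ifs
    · rw [hpl, ← act_mul, ← mul_assoc]
    · rw [hpr, ← act_mul, ← mul_assoc]

lemma act_single_apply (A : Mat m) (i j : Fin m) :
    act A (EuclideanSpace.single j (1 : ℂ)) i = A i j := by
  simp [act, EuclideanSpace.single]

lemma kernel_resolventU (hα : ∀ k, ‖α k‖ < 1) (hg : g ∈ Matrix.unitaryGroup (Fin m) ℂ)
    (hz : ‖z‖ ≠ 1) (hz0 : z ≠ 0) (k k' : ℤ) :
    kernel (resolventU α hα z) k k' = greenKernel α g k₀ z k k' := by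
  ext i j
  obtain ⟨φ, hφ, hφk⟩ := exists_green_column (k₀ := k₀) hα hg hz hz0 k'
    (EuclideanSpace.single j (1 : ℂ))
  rw [kernel, Matrix.of_apply, ← hφ, ← mul_apply_eq_comp, resolventU,
    Ring.inverse_mul_cancel _ (isUnit_opU_sub hα hz), ← act_single_apply (greenKernel α g k₀ z k k'),
    ← hφk]
  rfl

/-- Each block of the resolvent is holomorphic off the unit circle. -/
lemma analyticOnNhd_kernel_resolventU (hα : ∀ k, ‖α k‖ < 1) (k k' : ℤ) :
    AnalyticOnNhd ℂ (fun z => kernel (resolventU α hα z) k k') {z : ℂ | ‖z‖ ≠ 1} := by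
  have hopen : IsOpen {z : ℂ | ‖z‖ ≠ 1} := isOpen_ne_fun continuous_norm continuous_const
  refine DifferentiableOn.analyticOnNhd (fun z hz => ?_) hopen
  have hres : DifferentiableAt ℂ (resolventU α hα) z := by
    have h1 : DifferentiableAt ℂ (fun w : ℂ => opU α hα - w • (1 : L2 m →L[ℂ] L2 m)) z := by
      fun_prop
    exact (differentiableAt_inverse (isUnit_opU_sub hα hz)).comp z h1
  have hentry : ∀ i j, DifferentiableAt ℂ (fun w => kernel (resolventU α hα w) k k' i j) z := by
    intro i j
    have h1 : DifferentiableAt ℂ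
        (fun w => resolventU α hα w (lp.single 2 k' (EuclideanSpace.single j (1 : ℂ)))) z :=
      hres.clm_apply (differentiableAt_const _)
    exact (EuclideanSpace.proj i : Vec m →L[ℂ] ℂ).differentiableAt.comp z
      ((lp.evalCLM (𝕜 := ℂ) (fun _ : ℤ => Vec m) 2 k).differentiableAt.comp z h1)
  have hsum : (fun w => kernel (resolventU α hα w) k k') = fun w =>
      ∑ i, ∑ j, kernel (resolventU α hα w) k k' i j • Matrix.single i j (1 : ℂ) := by
    funext w
    conv_lhs => rw [Matrix.matrix_eq_sum_single (kernel (resolventU α hα w) k k')]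
    simp
  rw [hsum]
  exact (DifferentiableAt.fun_sum fun i _ => DifferentiableAt.fun_sum fun j _ =>
    (hentry i j).smul_const _).differentiableWithinAt

end Green

end CMV

theorem lemma3p14 {m : ℕ} (α : ℤ → CMV.Mat m) (hα : ∀ k, ‖α k‖ < 1) (k₀ : ℤ)
    (γ g : CMV.Mat m) (hγ : γ ∈ Matrix.unitaryGroup (Fin m) ℂ)
    (hg : g ∈ Matrix.unitaryGroup (Fin m) ℂ) (hgγ : g * g = γ) :
    (∀ z : ℂ, ‖z‖ ≠ 1 → z ≠ 0 →
      (∃! M : CMV.Mat m, CMV.IsWeyl (Set.Ici k₀) α g z k₀ M) ∧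
      (∃! M : CMV.Mat m, CMV.IsWeyl (Set.Iic k₀) α g z k₀ M) ∧
      (∀ k : ℤ, CMV.weylW α g z k₀ =
        -CMV.wronskian α (fun n => CMV.Uplus α g (1 / conj z) n k₀)
          (fun n => CMV.Uminus α g z n k₀) k) ∧
      IsUnit (CMV.weylW α g z k₀) ∧
      IsUnit (CMV.opU α hα - z • (1 : CMV.L2 m →L[ℂ] CMV.L2 m)) ∧
      ∀ k k' : ℤ,
        CMV.kernel (CMV.resolventU α hα z) k k' = CMV.greenKernel α g k₀ z k k') ∧
    (IsUnit (CMV.opU α hα) ∧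
      ∀ k k' : ℤ,
        AnalyticOnNhd ℂ
          (fun z : ℂ => if z = 0 then CMV.kernel (CMV.resolventU α hα 0) k k'
            else CMV.greenKernel α g k₀ z k k')
          {z : ℂ | ‖z‖ ≠ 1}) := by
  refine ⟨fun z hz hz0 => ⟨?_, ?_, fun k => CMV.weylW_eq_neg_wronskian hα hg hz hz0 k,
    CMV.isUnit_weylW hα hg hz hz0, CMV.isUnit_opU_sub hα hz,
    fun k k' => CMV.kernel_resolventU hα hg hz hz0 k k'⟩, ?_, fun k k' => ?_⟩
  · simpa only [CMV.isWeyl_Ici_iff] using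
      CMV.existsUnique_isWeylAt (k₀ := k₀) hα hg hz hz0 (.inl rfl)
  · simpa only [CMV.isWeyl_Iic_iff] using
      CMV.existsUnique_isWeylAt (k₀ := k₀) hα hg hz hz0 (.inr rfl)
  · simpa using CMV.isUnit_opU_sub hα (z := 0) (by simp)
  · have hopen : IsOpen {z : ℂ | ‖z‖ ≠ 1} := isOpen_ne_fun continuous_norm continuous_const
    refine (CMV.analyticOnNhd_kernel_resolventU hα k k').congr hopen fun z hz => ?_
    split_ifs with h0
    · rw [h0]
    · exact CMV.kernel_resolventU hα hg hz h0 k k'
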